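/- Let $\mathcal X$ be a measurable space (for instance $\mathbb R^p$, or a measurable subset of it), let $P$ be a probability measure on $\mathcal X\times\mathbb R$, and let $(x_i,y_i)_{i\ge 1}$ be independent random pairs with common law $P$; put $D_n=\{(x_i,y_i)\}_{i=1}^n$. Let $K$ be a measurable positive definite kernel on $\mathcal X$ (symmetric, with nonnegative quadratic forms) and let $\mathbb H_K$ be its reproducing kernel Hilbert space. For $\omega\in(0,1)$ let $\phi_\omega(t)=(1-\omega)t^2$ for $t\le 0$ and $\phi_\omega(t)=\omega t^2$ for $t>0$. For $f\in\mathbb H_K$ and $\alpha_0\in\mathbb R$ define the risk $$\mathcal R(f,\alpha_0)=E_{(x,y)\sim P}\,\phi_\omega\big(y-\alpha_0-f(x)\big),$$ and the ideal risk $\mathcal R^*=\inf_{f\in\mathbb H_K,\ \alpha_0\in\mathbb R}\mathcal R(f,\alpha_0)$. For $n\ge 1$ and a penalty $\lambda=\lambda_n>0$, the kernel expectile regression estimator is $$(\hat f,\hat\alpha_0)=\operatorname*{arg\,min}_{f\in\mathbb H_K,\ \alpha_0\in\mathbb R}\ \sum_{i=1}^n\phi_\omega\big(y_i-\alpha_0-f(x_i)\big)+\lambda_n\|f\|_{\mathbb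 H_K}^2 ,$$ and its observed risk is $\mathcal R(\hat f,\hat\alpha_0)$, a random variable that depends on $D_n$. Assume that $M=\sup_x K(x,x)^{1/2}<\infty$, that $E y^2<\infty$, and that, as $n\to\infty$, $\lambda_n/n^{2/3}\to\infty$ and $\lambda_n/n\to 0$. Then all the risks $\mathcal R(f,\alpha_0)$ are finite, the minimizer $(\hat f,\hat\alpha_0)$ exists and is unique for every data set of size $n\ge1$ and every $\lambda_n>0$, the observed risk is integrable, the expected observed risk satisfies $$E_{D_n}\mathcal R(\hat f,\hat\alpha_0)\longrightarrow \mathcal R^*\qquad (n\to\infty),$$ and hence $\mathcal R(\hat f,\hat\alpha_0)-\mathcal R^*\to 0$ in probability. -/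

import Mathlib

open MeasureTheory ProbabilityTheory Filter Topology

namespace Expectile

/-- A (real) positive definite kernel on `X`: symmetric, with nonnegative quadratic forms. -/
structure PosDefKernel (X : Type*) where
  /-- The kernel function. -/
  toFun : X → X → ℝ
  symm : ∀ x y, toFun x y = toFun y x
  nonneg : ∀ (s : Finset X) (c : X → ℝ), 0 ≤ ∑ x ∈ s, ∑ y ∈ s, c x * c y * toFun x y

instance {X : Type*} : CoeFun (PosDefKernel X) (fun _ => X → X → ℝ) := ⟨PosDefKernel.toFun⟩

/-- The kernel, its real values being seen as operators `ℝ →L[ℝ] ℝ`, which is the form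
that Mathlib's construction of the reproducing kernel Hilbert space takes. -/
noncomputable def PosDefKernel.matrix {X : Type*} (K : PosDefKernel X) :
    Matrix X X (ℝ →L[ℝ] ℝ) :=
  Matrix.of fun x y => K x y • (1 : ℝ →L[ℝ] ℝ)

theorem PosDefKernel.posSemidef_matrix {X : Type*} (K : PosDefKernel X) :
    K.matrix.PosSemidef := by
  have key := (RKHS.posSemidef_tfae (K := K.matrix)).out 0 2
  refine key.2 ⟨?_, fun v => ?_⟩
  · ext x y
    simp [PosDefKernel.matrix, K.symm y x]
  · have h := K.nonneg v.support v
    simp only [PosDefKernel.matrix, Finsupp.sum]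
    refine le_of_le_of_eq h ?_
    simp only [RCLike.re_to_real]
    refine Finset.sum_congr rfl fun x _ => Finset.sum_congr rfl fun y _ => ?_
    simp [K.symm y x]
    ring

instance {X : Type*} (K : PosDefKernel X) : Fact K.matrix.PosSemidef := ⟨K.posSemidef_matrix⟩

/-- The reproducing kernel Hilbert space `H_K` of the kernel `K`; its elements are
functions on `X` through Mathlib's class `RKHS`. -/
abbrev PosDefKernel.Space {X : Type*} (K : PosDefKernel X) : Type _ := RKHS.OfKernel K.matrix

/-- The expectile (asymmetric squared) loss `φ_w`. -/
noncomputable def loss (w t : ℝ) : ℝ := if t ≤ 0 then (1 - w) * t ^ 2 else w * t ^ 2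

/-- The expectile risk `R(f, a) = E φ_w (y - a - f x)` when `(x, y)` has law `P`. -/
noncomputable def risk {X : Type*} [MeasurableSpace X] (w : ℝ) (P : Measure (X × ℝ))
    (f : X → ℝ) (a : ℝ) : ℝ :=
  ∫ z, loss w (z.2 - a - f z.1) ∂P

/-- The ideal risk: the infimum of `R(f, a)` over `f ∈ H_K` and `a ∈ ℝ`. -/
noncomputable def idealRisk {X : Type*} [MeasurableSpace X] (w : ℝ) (P : Measure (X × ℝ))
    (K : PosDefKernel X) : ℝ :=
  ⨅ q : K.Space × ℝ, risk w P q.1 q.2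

/-- The penalized empirical objective `∑ φ_w (y_i - a - f x_i) + l ‖f‖²` at `(f, a)`. -/
noncomputable def objective {X : Type*} (w : ℝ) (K : PosDefKernel X) (l : ℝ) {n : ℕ}
    (d : Fin n → X × ℝ) (q : K.Space × ℝ) : ℝ :=
  (∑ i, loss w ((d i).2 - q.2 - q.1 (d i).1)) + l * ‖q.1‖ ^ 2

/-- `q = (f, a)` minimizes the penalized empirical objective over `H_K × ℝ`. -/
def IsMinimizer {X : Type*} (w : ℝ) (K : PosDefKernel X) (l : ℝ) {n : ℕ}
    (d : Fin n → X × ℝ) (q : K.Space × ℝ) : Prop :=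
  ∀ q' : K.Space × ℝ, objective w K l d q ≤ objective w K l d q'

/-- The kernel expectile regression estimator trained on the data `d` with penalty `l`:
the minimizer of the penalized empirical objective. -/
noncomputable def estimator {X : Type*} (w : ℝ) (K : PosDefKernel X) (l : ℝ) {n : ℕ}
    (d : Fin n → X × ℝ) : K.Space × ℝ :=
  Classical.epsilon (IsMinimizer w K l d)

/-- The observed risk `R(f̂, â)` of the estimator trained on the data `d`. -/
noncomputable def observedRisk {X : Type*} [MeasurableSpace X] (w : ℝ) (P : Measure (X × ℝ))
    (K : PosDefKernel X) (l : ℝ) {n : ℕ} (d : Fin n → X × ℝ) : ℝ :=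
  risk w P (estimator w K l d).1 (estimator w K l d).2

end Expectile

/-! Divided by `n`, the objective is an empirical version of the penalized risk `penRisk` with
weight `l = λ_n / n`. The loss has quadratic upper and lower bounds around every point
(`loss_add_le`, `le_loss_add`), and `|f x| ≤ M ‖f‖`. Hence the penalized risk is strongly convex in
`(f, a)`, for `P` as for the empirical measure, and each has a unique minimizer satisfying a
first-order condition (`integral_score_mul_predict`).

Let `q` be the minimizer for `P` and `v` the estimator minus `q`. Empirical strong convexity bounds
`v` by the empirical gradient at `q`, and the upper quadratic bound turns this into a bound on the
observed risk, valid for every data set (`observedRisk_le`). Since `q` is deterministic, no uniform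
law of large numbers is needed: the empirical gradient at `q` is a sum of `n` centred i.i.d. terms,
so its second moment is `O(n)` (`integral_scoreSum_sq_le`, `integral_norm_gradFst_sq_le`). The
expected observed risk is therefore at most `penRisk w P l p + O((1 + 1 / l) ^ 2 / n)` for every
fixed `p` (`integral_observedRisk_le`). The error vanishes because `n / λ_n ^ 2 → 0`, the penalty of
`p` because `λ_n / n → 0`, and `p` may be nearly optimal. The excess risk is nonnegative, so
Markov's inequality gives convergence in probability.

The estimator is defined by choice, so its measurability needs an argument: it is the limit of
gradient descent, whose iterates are explicit measurable functions of the data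
(`jointlyMeasurable_estimator`). -/

namespace Expectile

open scoped RealInnerProductSpace

/-! ### The expectile loss -/

/-- The derivative of the expectile loss. -/
noncomputable def slope (w t : ℝ) : ℝ := if t ≤ 0 then 2 * (1 - w) * t else 2 * w * t

section Loss

variable {w : ℝ}

theorem loss_nonneg (hw0 : 0 < w) (hw1 : w < 1) (t : ℝ) : 0 ≤ loss w t := by
  unfold loss
  have := sub_pos.2 hw1
  split_ifs <;> positivity

theorem loss_le_sq (hw0 : 0 < w) (hw1 : w < 1) (t : ℝ) : loss w t ≤ t ^ 2 := by
  unfold loss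
  split_ifs <;> nlinarith [sq_nonneg t]

/-- On each branch the left side is `4 * loss w t` times a weight below `1`. This bounds the second
moment of the score by the risk. -/
theorem slope_sq_le (hw0 : 0 < w) (hw1 : w < 1) (t : ℝ) : slope w t ^ 2 ≤ 4 * loss w t := by
  unfold loss slope
  split_ifs
  · nlinarith [mul_nonneg (mul_nonneg hw0.le (sub_pos.2 hw1).le) (sq_nonneg t)]
  · nlinarith [mul_nonneg (mul_nonneg hw0.le (sub_pos.2 hw1).le) (sq_nonneg t)]

theorem abs_slope_le (hw0 : 0 < w) (hw1 : w < 1) (t : ℝ) : |slope w t| ≤ 2 * |t| := by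
  have h := (slope_sq_le hw0 hw1 t).trans
    (mul_le_mul_of_nonneg_left (loss_le_sq hw0 hw1 t) (by norm_num : (0 : ℝ) ≤ 4))
  have h' : slope w t ^ 2 ≤ (2 * t) ^ 2 := h.trans_eq (by ring)
  simpa [abs_mul] using sq_le_sq.1 h'

theorem loss_add_le (hw0 : 0 < w) (hw1 : w < 1) (s u : ℝ) :
    loss w (s + u) ≤ loss w s + slope w s * u + u ^ 2 := by
  unfold loss slope
  split_ifs with h1 h2 h2
  · nlinarith [mul_nonneg hw0.le (sq_nonneg u)]
  · nlinarith [mul_nonneg hw0.le (sq_nonneg u), mul_nonneg hw0.le (sq_nonneg (s + u)),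
      mul_nonneg (sub_pos.2 hw1).le (sq_nonneg s), mul_nonneg (sub_pos.2 hw1).le
      (mul_nonneg (not_le.1 h2).le (neg_nonneg.2 h1))]
  · nlinarith [mul_nonneg hw0.le (mul_nonneg (not_le.1 h1).le (neg_nonneg.2 h2)),
      mul_nonneg hw0.le (sq_nonneg s)]
  · nlinarith [mul_nonneg (sub_pos.2 hw1).le (sq_nonneg u)]

theorem le_loss_add {c : ℝ} (hcw : c ≤ w) (hcw' : c ≤ 1 - w) (s u : ℝ) :
    loss w s + slope w s * u + c * u ^ 2 ≤ loss w (s + u) := by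
  unfold loss slope
  split_ifs with h1 h2 h2
  · nlinarith [mul_nonneg (sub_nonneg.2 hcw') (sq_nonneg u)]
  · have h2 := not_le.1 h2
    nlinarith [mul_nonneg (sub_nonneg.2 hcw') (sq_nonneg s),
      mul_nonneg (sub_nonneg.2 hcw') (mul_nonneg h2.le (neg_nonneg.2 h1)),
      mul_nonneg (sub_nonneg.2 hcw) (sq_nonneg (s + u))]
  · have h1 := not_le.1 h1
    nlinarith [mul_nonneg (sub_nonneg.2 hcw) (sq_nonneg s),
      mul_nonneg (sub_nonneg.2 hcw) (mul_nonneg h1.le (neg_nonneg.2 h2)),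
      mul_nonneg (sub_nonneg.2 hcw') (sq_nonneg (s + u))]
  · nlinarith [mul_nonneg (sub_nonneg.2 hcw) (sq_nonneg u)]

/-- Sum of the two lower quadratic bounds, at `s` and at `t`. -/
theorem le_slope_sub_mul {c : ℝ} (hcw : c ≤ w) (hcw' : c ≤ 1 - w) (s t : ℝ) :
    2 * c * (s - t) ^ 2 ≤ (slope w s - slope w t) * (s - t) := by
  have h1 := le_loss_add hcw hcw' s (t - s)
  have h2 := le_loss_add hcw hcw' t (s - t)
  rw [add_sub_cancel] at h1 h2
  linarith [sq_nonneg (s - t), show c * (t - s) ^ 2 = c * (s - t) ^ 2 by ring]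

theorem abs_slope_sub_le (hw0 : 0 < w) (hw1 : w < 1) (s t : ℝ) :
    |slope w s - slope w t| ≤ 2 * |s - t| := by
  unfold slope
  rcases le_total s t with h | h
  · rw [abs_of_nonpos (sub_nonpos.2 h), abs_le]
    split_ifs <;> constructor <;> nlinarith
  · rw [abs_of_nonneg (sub_nonneg.2 h), abs_le]
    split_ifs <;> constructor <;> nlinarith

theorem measurable_loss : Measurable (loss w) :=
  Measurable.ite measurableSet_Iic (by fun_prop) (by fun_prop)

theorem measurable_slope : Measurable (slope w) :=
  Measurable.ite measurableSet_Iic (by fun_prop) (by fun_prop)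

end Loss

/-! ### The reproducing kernel Hilbert space -/

section Space

variable {X : Type*} (K : PosDefKernel X)

/-- The kernel section at `x`, as an element of the reproducing kernel Hilbert space. -/
noncomputable def PosDefKernel.feature (x : X) : K.Space := RKHS.kerFun K.Space x 1

variable {K}

theorem inner_feature (f : K.Space) (x : X) : ⟪f, K.feature x⟫ = f x := by
  simp [PosDefKernel.feature]

theorem feature_apply (x y : X) : K.feature y x = K x y := by
  rw [PosDefKernel.feature, RKHS.kerFun_apply, RKHS.OfKernel.kernel_ofKernel]
  simp [PosDefKernel.matrix]

theorem norm_feature_sq (x : X) : ‖K.feature x‖ ^ 2 = K x x := by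
  rw [← real_inner_self_eq_norm_sq, inner_feature, feature_apply]

theorem norm_feature_le {M : ℝ} (hM0 : 0 ≤ M) (hM : ∀ x, K x x ≤ M ^ 2) (x : X) :
    ‖K.feature x‖ ≤ M :=
  le_of_sq_le_sq ((norm_feature_sq x).trans_le (hM x)) hM0

theorem abs_apply_le {M : ℝ} (hM0 : 0 ≤ M) (hM : ∀ x, K x x ≤ M ^ 2) (f : K.Space) (x : X) :
    |f x| ≤ M * ‖f‖ := by
  rw [← inner_feature, mul_comm]
  exact (abs_real_inner_le_norm _ _).trans
    (mul_le_mul_of_nonneg_left (norm_feature_le hM0 hM x) (norm_nonneg _))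

theorem abs_kernel_le {M : ℝ} (hM0 : 0 ≤ M) (hM : ∀ x, K x x ≤ M ^ 2) (x y : X) :
    |K x y| ≤ M ^ 2 := by
  rw [← feature_apply, sq]
  exact (abs_apply_le hM0 hM _ _).trans
    (mul_le_mul_of_nonneg_left (norm_feature_le hM0 hM y) hM0)

/-- Norm convergence implies pointwise convergence, so the measurable elements form a closed
subspace; it contains the kernel sections, whose span is dense. -/
theorem measurable_coe [MeasurableSpace X] (hK : Measurable fun z : X × X => K z.1 z.2)
    (f : K.Space) : Measurable f := by
  let S : Submodule ℝ K.Space :=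
    { carrier := {f | Measurable f}
      add_mem' := fun {f g} hf hg => by
        simpa using Measurable.add (f := f) (g := g) hf hg
      zero_mem' := by simp only [Set.mem_ofPred_eq, RKHS.coe_zero]; exact measurable_zero
      smul_mem' := fun r f hf => by
        simp only [Set.mem_ofPred_eq, RKHS.coe_smul] at hf ⊢
        exact hf.const_smul r }
  have hcl : IsClosed (S : Set K.Space) := by
    refine IsSeqClosed.isClosed fun u g hu hg => ?_
    refine measurable_of_tendsto_metrizable hu (tendsto_pi_nhds.2 fun x => ?_)
    exact ((RKHS.continuous_eval x).tendsto g).comp hg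
  have htop : (⊤ : Submodule ℝ K.Space) ≤ S := by
    rw [← RKHS.kerFun_dense K.Space]
    refine Submodule.topologicalClosure_minimal _ (Submodule.span_le.2 ?_) hcl
    rintro _ ⟨y, v, rfl⟩
    change Measurable fun x => RKHS.kerFun K.Space y v x
    have : (fun x => RKHS.kerFun K.Space y v x) = fun x => K x y * v := by
      ext x
      rw [RKHS.kerFun_apply, RKHS.OfKernel.kernel_ofKernel]
      simp [PosDefKernel.matrix]
    rw [this]
    exact (hK.comp measurable_prodMk_right).mul_const v
  exact htop (Submodule.mem_top (x := f))

end Space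

/-! ### Strongly convex minimization -/

section Minimization

variable {E : Type*} [NormedAddCommGroup E] [NormedSpace ℝ E] {F : E → ℝ} {κ : ℝ}

/-- A minimizing sequence is Cauchy: the value at a midpoint is at least the infimum, so `κ ‖u i - u
j‖ ^ 2` is at most the mean of the two excesses. -/
theorem exists_forall_le_of_midpoint [CompleteSpace E] (hF : Continuous F) (hF0 : ∀ x, 0 ≤ F x)
    (hκ : 0 < κ) (h : ∀ p q, F ((1 / 2 : ℝ) • (p + q)) ≤ (F p + F q) / 2 - κ * ‖p - q‖ ^ 2) :
    ∃ q, ∀ q', F q ≤ F q' := by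
  have hbdd : BddBelow (Set.range F) := ⟨0, by rintro _ ⟨x, rfl⟩; exact hF0 x⟩
  have hex : ∀ k : ℕ, ∃ x, F x < (⨅ x, F x) + 1 / ((k : ℝ) + 1) := fun k =>
    exists_lt_of_ciInf_lt (lt_add_of_pos_right _ (by positivity))
  choose u hu using hex
  have hlim : Tendsto (fun k : ℕ => √((1 / ((k : ℝ) + 1)) / κ)) atTop (𝓝 0) := by
    have := (tendsto_one_div_add_atTop_nhds_zero_nat (𝕜 := ℝ)).div_const κ
    simpa using this.sqrt
  have hc : CauchySeq u := by
    refine cauchySeq_of_le_tendsto_0 _ (fun i j k hi hj => ?_) hlim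
    rw [dist_eq_norm]
    refine Real.le_sqrt_of_sq_le ((le_div_iff₀' hκ).2 ?_)
    have h1 : (⨅ x, F x) ≤ F ((1 / 2 : ℝ) • (u i + u j)) := ciInf_le hbdd _
    have h2 := h (u i) (u j)
    have h3 := one_div_le_one_div_of_le (by positivity : (0 : ℝ) < (k : ℝ) + 1)
      (by exact_mod_cast Nat.succ_le_succ hi : (k : ℝ) + 1 ≤ (i : ℝ) + 1)
    have h4 := one_div_le_one_div_of_le (by positivity : (0 : ℝ) < (k : ℝ) + 1)
      (by exact_mod_cast Nat.succ_le_succ hj : (k : ℝ) + 1 ≤ (j : ℝ) + 1)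
    linarith [hu i, hu j]
  obtain ⟨q, hq⟩ := cauchySeq_tendsto_of_complete hc
  refine ⟨q, fun q' => le_trans ?_ (ciInf_le hbdd q')⟩
  have h1 : Tendsto (fun k => F (u k)) atTop (𝓝 (F q)) := (hF.tendsto q).comp hq
  have h2 := (tendsto_one_div_add_atTop_nhds_zero_nat (𝕜 := ℝ)).const_add (⨅ x, F x)
  rw [add_zero] at h2
  exact le_of_tendsto_of_tendsto' h1 h2 fun k => (hu k).le

theorem eq_of_forall_le_of_midpoint (hκ : 0 < κ)
    (h : ∀ p q, F ((1 / 2 : ℝ) • (p + q)) ≤ (F p + F q) / 2 - κ * ‖p - q‖ ^ 2) {p q : E}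
    (hp : ∀ q', F p ≤ F q') (hq : ∀ q', F q ≤ F q') : p = q := by
  have h1 := h p q
  have h2 := hp ((1 / 2 : ℝ) • (p + q))
  have h3 := hq p
  have h4 : ‖p - q‖ ^ 2 ≤ 0 := by
    by_contra hn
    nlinarith [mul_pos hκ (not_le.1 hn)]
  exact sub_eq_zero.1 (norm_eq_zero.1 (pow_eq_zero_iff two_ne_zero |>.1
    (le_antisymm h4 (sq_nonneg _))))

theorem eq_zero_of_forall_mul_add_sq_nonneg {a b : ℝ} (h : ∀ t : ℝ, 0 ≤ t * a + t ^ 2 * b) :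
    a = 0 := by
  by_contra ha
  have hb : 0 < |b| + 1 := by positivity
  have h1 := h (-a / (|b| + 1))
  have h2 : -a / (|b| + 1) * a + (-a / (|b| + 1)) ^ 2 * b
      = a ^ 2 / (|b| + 1) ^ 2 * (b - (|b| + 1)) := by
    field_simp
    ring
  rw [h2] at h1
  have h3 : 0 < a ^ 2 / (|b| + 1) ^ 2 := by positivity
  nlinarith [le_abs_self b]

end Minimization

/-! ### Penalized risks -/

/-- The standing bounds on the asymmetry `w` and the kernel `K`: the loss has curvature
between `c` and `1`, and the kernel is measurable with diagonal at most `M ^ 2`. -/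
structure Bounds {X : Type*} [MeasurableSpace X] (K : PosDefKernel X) (w c M : ℝ) : Prop where
  w_pos : 0 < w
  w_lt_one : w < 1
  c_pos : 0 < c
  c_le : c ≤ w
  c_le' : c ≤ 1 - w
  M_nonneg : 0 ≤ M
  diag_le : ∀ x, K x x ≤ M ^ 2
  meas : Measurable fun z : X × X => K z.1 z.2

section PenalizedRisk

variable {X : Type*} {K : PosDefKernel X} {w c M l : ℝ}

/-- The prediction at the observation `z` of the pair `q = (f, a)`. -/
noncomputable def predict (q : K.Space × ℝ) (z : X × ℝ) : ℝ := q.2 + q.1 z.1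

/-- The slope of the loss at the residual of `q = (f, a)` at the observation `z`. -/
noncomputable def score (w : ℝ) (q : K.Space × ℝ) (z : X × ℝ) : ℝ :=
  slope w (z.2 - q.2 - q.1 z.1)

theorem predict_smul (t : ℝ) (q : K.Space × ℝ) (z : X × ℝ) :
    predict (t • q) z = t * predict q z := by
  simp only [predict, Prod.smul_fst, Prod.smul_snd, RKHS.coe_smul, Pi.smul_apply, smul_eq_mul]
  ring

theorem residual_add (q v : K.Space × ℝ) (z : X × ℝ) :
    z.2 - (q + v).2 - (q + v).1 z.1 = (z.2 - q.2 - q.1 z.1) + -predict v z := by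
  simp only [predict, Prod.fst_add, Prod.snd_add, RKHS.coe_add, Pi.add_apply]
  ring

theorem norm_add_sq_fst (q v : K.Space × ℝ) :
    ‖(q + v).1‖ ^ 2 = ‖q.1‖ ^ 2 + 2 * ⟪q.1, v.1⟫ + ‖v.1‖ ^ 2 := by
  rw [Prod.fst_add, norm_add_sq_real]

variable [MeasurableSpace X] {Q : Measure (X × ℝ)}

/-- The penalized risk `∫ φ_w (y - a - f x) dQ + l ‖f‖²`. -/
noncomputable def penRisk (w : ℝ) (Q : Measure (X × ℝ)) (l : ℝ) (q : K.Space × ℝ) : ℝ :=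
  risk w Q q.1 q.2 + l * ‖q.1‖ ^ 2

namespace Bounds

theorem risk_nonneg (hB : Bounds K w c M) (q : K.Space × ℝ) : 0 ≤ risk w Q q.1 q.2 :=
  integral_nonneg fun _ => loss_nonneg hB.w_pos hB.w_lt_one _

variable [IsFiniteMeasure Q]

theorem abs_predict_le (hB : Bounds K w c M) (q : K.Space × ℝ) (z : X × ℝ) :
    |predict q z| ≤ |q.2| + M * ‖q.1‖ :=
  (abs_add_le _ _).trans (add_le_add_right (abs_apply_le hB.M_nonneg hB.diag_le _ _) _)

theorem measurable_predict (hB : Bounds K w c M) (q : K.Space × ℝ) :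
    Measurable (predict q) :=
  ((measurable_coe hB.meas q.1).comp measurable_fst).const_add q.2

theorem measurable_residual (hB : Bounds K w c M) (q : K.Space × ℝ) :
    Measurable fun z : X × ℝ => z.2 - q.2 - q.1 z.1 :=
  (measurable_snd.sub_const _).sub ((measurable_coe hB.meas q.1).comp measurable_fst)

theorem measurable_score (hB : Bounds K w c M) (q : K.Space × ℝ) : Measurable (score w q) :=
  measurable_slope.comp (hB.measurable_residual q)

theorem memLp_predict (hB : Bounds K w c M) (q : K.Space × ℝ) (p : ENNReal) :
    MemLp (predict q) p Q :=
  MemLp.of_bound (hB.measurable_predict q).aestronglyMeasurable _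
    (ae_of_all _ fun z => hB.abs_predict_le q z)

theorem memLp_residual (hB : Bounds K w c M) (hy : Integrable (fun z : X × ℝ => z.2 ^ 2) Q)
    (q : K.Space × ℝ) : MemLp (fun z : X × ℝ => z.2 - q.2 - q.1 z.1) 2 Q := by
  have h1 : MemLp (fun z : X × ℝ => z.2) 2 Q :=
    (memLp_two_iff_integrable_sq measurable_snd.aestronglyMeasurable).2 hy
  refine (h1.sub (hB.memLp_predict q 2)).ae_eq (ae_of_all _ fun z => ?_)
  simp only [predict, Pi.sub_apply]
  ring

theorem integrable_loss (hB : Bounds K w c M) (hy : Integrable (fun z : X × ℝ => z.2 ^ 2) Q)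
    (q : K.Space × ℝ) : Integrable (fun z => loss w (z.2 - q.2 - q.1 z.1)) Q := by
  refine (hB.memLp_residual hy q).integrable_sq.mono'
    (measurable_loss.comp (hB.measurable_residual q)).aestronglyMeasurable
    (ae_of_all _ fun z => ?_)
  rw [Real.norm_of_nonneg (loss_nonneg hB.w_pos hB.w_lt_one _)]
  exact loss_le_sq hB.w_pos hB.w_lt_one _

theorem memLp_score (hB : Bounds K w c M) (hy : Integrable (fun z : X × ℝ => z.2 ^ 2) Q)
    (q : K.Space × ℝ) : MemLp (score w q) 2 Q :=
  (hB.memLp_residual hy q).of_le_mul (hB.measurable_score q).aestronglyMeasurable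
    (ae_of_all _ fun _ => abs_slope_le hB.w_pos hB.w_lt_one _)

theorem integrable_score_mul (hB : Bounds K w c M)
    (hy : Integrable (fun z : X × ℝ => z.2 ^ 2) Q) (q v : K.Space × ℝ) :
    Integrable (fun z => score w q z * predict v z) Q :=
  (hB.memLp_score hy q).integrable_mul (hB.memLp_predict v 2)

theorem integrable_predict_sq (hB : Bounds K w c M) (v : K.Space × ℝ) :
    Integrable (fun z => predict v z ^ 2) Q :=
  (hB.memLp_predict v 2).integrable_sq

/-- Adding `v` to `q` shifts the residual by `-predict v z`, hence the minus sign before the score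
term. -/
theorem risk_add_le (hB : Bounds K w c M) (hy : Integrable (fun z : X × ℝ => z.2 ^ 2) Q)
    (q v : K.Space × ℝ) :
    risk w Q (q + v).1 (q + v).2 ≤
      risk w Q q.1 q.2 - ∫ z, score w q z * predict v z ∂Q + ∫ z, predict v z ^ 2 ∂Q := by
  have hi : Integrable (fun z => loss w (z.2 - q.2 - q.1 z.1) - score w q z * predict v z) Q :=
    (hB.integrable_loss hy q).sub (hB.integrable_score_mul hy q v)
  unfold risk
  rw [← integral_sub (hB.integrable_loss hy q) (hB.integrable_score_mul hy q v),
    ← integral_add hi (hB.integrable_predict_sq v)]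
  refine integral_mono (hB.integrable_loss hy (q + v))
    (hi.add (hB.integrable_predict_sq v)) fun z => ?_
  have h := loss_add_le hB.w_pos hB.w_lt_one (z.2 - q.2 - q.1 z.1) (-predict v z)
  rw [← residual_add] at h
  simp only [score]
  linarith [neg_sq (predict v z)]

theorem le_risk_add (hB : Bounds K w c M) (hy : Integrable (fun z : X × ℝ => z.2 ^ 2) Q)
    (q v : K.Space × ℝ) :
    risk w Q q.1 q.2 - ∫ z, score w q z * predict v z ∂Q + c * ∫ z, predict v z ^ 2 ∂Q ≤
      risk w Q (q + v).1 (q + v).2 := by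
  have hi : Integrable (fun z => loss w (z.2 - q.2 - q.1 z.1) - score w q z * predict v z) Q :=
    (hB.integrable_loss hy q).sub (hB.integrable_score_mul hy q v)
  unfold risk
  rw [← integral_sub (hB.integrable_loss hy q) (hB.integrable_score_mul hy q v),
    ← integral_const_mul,
    ← integral_add hi ((hB.integrable_predict_sq v).const_mul c)]
  refine integral_mono (hi.add ((hB.integrable_predict_sq v).const_mul c)) (hB.integrable_loss hy (q + v)) fun z => ?_
  have h := le_loss_add hB.c_le hB.c_le' (z.2 - q.2 - q.1 z.1) (-predict v z)
  rw [← residual_add] at h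
  simp only [score]
  linarith [neg_sq (predict v z), congrArg (c * ·) (neg_sq (predict v z))]

theorem integral_predict_sq_le (hB : Bounds K w c M) (v : K.Space × ℝ) :
    ∫ z, predict v z ^ 2 ∂Q ≤ (|v.2| + M * ‖v.1‖) ^ 2 * Q.real Set.univ := by
  refine (integral_mono (hB.integrable_predict_sq v)
    (integrable_const ((|v.2| + M * ‖v.1‖) ^ 2)) fun z => ?_).trans_eq ?_
  · exact sq_le_sq' (abs_le.1 (hB.abs_predict_le v z)).1 (abs_le.1 (hB.abs_predict_le v z)).2
  · simp [mul_comm]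

/-- The intercept is not penalized; it is recovered as prediction minus `f x`, with `|f x| ≤ M ‖f‖`.
Only the mass of `Q` enters the constant, so the bound serves both `P` and the empirical measure. -/
theorem norm_sq_add_sq_le (hB : Bounds K w c M) (hQ : 0 < Q.real Set.univ) (hl : 0 < l)
    (v : K.Space × ℝ) :
    ‖v.1‖ ^ 2 + v.2 ^ 2 ≤ (2 / (Q.real Set.univ * c) + (2 * M ^ 2 + 1) / l) *
      (c * ∫ z, predict v z ^ 2 ∂Q + l * ‖v.1‖ ^ 2) := by
  have hc := hB.c_pos
  have h1 : v.2 ^ 2 * Q.real Set.univ ≤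
      2 * ∫ z, predict v z ^ 2 ∂Q + 2 * M ^ 2 * ‖v.1‖ ^ 2 * Q.real Set.univ := by
    have : ∫ _ : X × ℝ, v.2 ^ 2 ∂Q ≤
        ∫ z, (2 * predict v z ^ 2 + 2 * M ^ 2 * ‖v.1‖ ^ 2) ∂Q := by
      refine integral_mono (integrable_const _)
        (((hB.integrable_predict_sq v).const_mul 2).add (integrable_const _)) fun z => ?_
      have h2 : v.1 z.1 ^ 2 ≤ (M * ‖v.1‖) ^ 2 :=
        sq_le_sq' (abs_le.1 (abs_apply_le hB.M_nonneg hB.diag_le v.1 z.1)).1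
          (abs_le.1 (abs_apply_le hB.M_nonneg hB.diag_le v.1 z.1)).2
      simp only [predict]
      nlinarith [sq_nonneg (v.2 + 2 * v.1 z.1)]
    rw [integral_add ((hB.integrable_predict_sq v).const_mul 2) (integrable_const _),
      integral_const_mul, integral_const, integral_const] at this
    simp only [smul_eq_mul] at this
    linarith
  have hI : 0 ≤ ∫ z, predict v z ^ 2 ∂Q := integral_nonneg fun z => sq_nonneg _
  set I := ∫ z, predict v z ^ 2 ∂Q
  set m := Q.real Set.univ
  have h3 : v.2 ^ 2 ≤ 2 / m * I + 2 * M ^ 2 * ‖v.1‖ ^ 2 := by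
    rw [← mul_le_mul_iff_left₀ hQ]
    refine h1.trans_eq ?_
    field_simp
  have h4 : (2 / (m * c) + (2 * M ^ 2 + 1) / l) * (c * I + l * ‖v.1‖ ^ 2) =
      2 / m * I + (2 * M ^ 2 + 1) * ‖v.1‖ ^ 2 + 2 / (m * c) * (l * ‖v.1‖ ^ 2) +
        (2 * M ^ 2 + 1) / l * (c * I) := by
    field_simp
    ring
  have h5 : 0 ≤ 2 / (m * c) * (l * ‖v.1‖ ^ 2) + (2 * M ^ 2 + 1) / l * (c * I) := by positivity
  rw [h4]
  linarith

/-- The two quadratic bounds at `q` squeeze the increment of the risk. -/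
theorem continuous_penRisk (hB : Bounds K w c M)
    (hy : Integrable (fun z : X × ℝ => z.2 ^ 2) Q) :
    Continuous (penRisk (K := K) w Q l) := by
  have hrisk : Continuous fun q : K.Space × ℝ => risk w Q q.1 q.2 := by
    refine continuous_iff_continuousAt.2 fun q => ?_
    have hbound : ∀ p : K.Space × ℝ, |risk w Q p.1 p.2 - risk w Q q.1 q.2| ≤
        (|(p - q).2| + M * ‖(p - q).1‖) * (∫ z, |score w q z| ∂Q) +
          (|(p - q).2| + M * ‖(p - q).1‖) ^ 2 * Q.real Set.univ := by
      intro p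
      have h1 := hB.risk_add_le hy q (p - q)
      have h2 := hB.le_risk_add hy q (p - q)
      have h3 := hB.integral_predict_sq_le (Q := Q) (p - q)
      have h4 : 0 ≤ c * ∫ z, predict (p - q) z ^ 2 ∂Q :=
        mul_nonneg hB.c_pos.le (integral_nonneg fun z => sq_nonneg _)
      have h5 : |∫ z, score w q z * predict (p - q) z ∂Q| ≤
          (|(p - q).2| + M * ‖(p - q).1‖) * ∫ z, |score w q z| ∂Q := by
        rw [← integral_const_mul]
        refine (abs_integral_le_integral_abs).trans (integral_mono
          (hB.integrable_score_mul hy q (p - q)).abs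
          ((((hB.memLp_score hy q).integrable one_le_two).abs).const_mul _) fun z => ?_)
        simp only [abs_mul]
        rw [mul_comm]
        exact mul_le_mul_of_nonneg_right (hB.abs_predict_le _ z) (abs_nonneg _)
      rw [add_sub_cancel] at h1 h2
      have h6 := abs_le.1 h5
      have h7 : 0 ≤ (|(p - q).2| + M * ‖(p - q).1‖) ^ 2 * Q.real Set.univ := by positivity
      rw [abs_le]
      constructor <;> linarith
    refine tendsto_iff_norm_sub_tendsto_zero.2 (squeeze_zero (fun _ => norm_nonneg _) hbound ?_)
    have hcont : Continuous fun p : K.Space × ℝ =>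
        (|(p - q).2| + M * ‖(p - q).1‖) * (∫ z, |score w q z| ∂Q) +
          (|(p - q).2| + M * ‖(p - q).1‖) ^ 2 * Q.real Set.univ := by fun_prop
    simpa using hcont.tendsto q
  exact hrisk.add (by fun_prop)

/-- In the lower expansions at the midpoint in the directions `d` and `-d` the linear terms cancel
and the curvature remains; the parallelogram law treats the penalty. The factor `4` comes from `p -
q = 2 d`. -/
theorem penRisk_midpoint (hB : Bounds K w c M)
    (hy : Integrable (fun z : X × ℝ => z.2 ^ 2) Q) (hl : 0 < l) (hQ : 0 < Q.real Set.univ)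
    (p q : K.Space × ℝ) :
    penRisk w Q l ((1 / 2 : ℝ) • (p + q)) ≤ (penRisk w Q l p + penRisk w Q l q) / 2 -
      1 / (4 * (2 / (Q.real Set.univ * c) + (2 * M ^ 2 + 1) / l)) * ‖p - q‖ ^ 2 := by
  have hc := hB.c_pos
  set m : K.Space × ℝ := (1 / 2 : ℝ) • (p + q)
  set d : K.Space × ℝ := (1 / 2 : ℝ) • (p - q) with hd
  have hp : p = m + d := by simp only [m, d]; module
  have hq : q = m + (-1 : ℝ) • d := by simp only [m, d]; module
  have h1 := hB.le_risk_add hy m d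
  have h2 := hB.le_risk_add hy m ((-1 : ℝ) • d)
  rw [← hp] at h1
  rw [← hq] at h2
  have e1 : ∫ z, score w m z * predict ((-1 : ℝ) • d) z ∂Q =
      -∫ z, score w m z * predict d z ∂Q := by
    rw [← integral_neg]
    refine integral_congr_ae (ae_of_all _ fun z => ?_)
    simp only [predict_smul]
    ring
  have e2 : ∫ z, predict ((-1 : ℝ) • d) z ^ 2 ∂Q = ∫ z, predict d z ^ 2 ∂Q := by
    refine integral_congr_ae (ae_of_all _ fun z => ?_)
    simp only [predict_smul]
    ring
  rw [e1, e2] at h2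
  have e3 : ‖p.1‖ ^ 2 + ‖q.1‖ ^ 2 = 2 * (‖m.1‖ ^ 2 + ‖d.1‖ ^ 2) := by
    have := parallelogram_law_with_norm ℝ m.1 d.1
    have e : q.1 = m.1 - d.1 := by
      rw [hq]
      simp [sub_eq_add_neg]
    rw [hp, hq] at *
    simp only [Prod.fst_add, Prod.smul_fst] at *
    rw [e]
    nlinarith
  have h3 := hB.norm_sq_add_sq_le hQ hl d
  set B := 2 / (Q.real Set.univ * c) + (2 * M ^ 2 + 1) / l with hBdef
  have hBpos : 0 < B := by positivity
  have h4 : ‖p - q‖ ^ 2 ≤ 4 * (‖d.1‖ ^ 2 + d.2 ^ 2) := by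
    have hn : ‖p - q‖ = 2 * ‖d‖ := by
      rw [hd, norm_smul, Real.norm_of_nonneg (by norm_num)]; ring
    have : ‖d‖ ^ 2 ≤ ‖d.1‖ ^ 2 + d.2 ^ 2 := by
      rw [Prod.norm_def]
      rcases max_choice ‖d.1‖ ‖d.2‖ with h | h <;> rw [h]
      · nlinarith [sq_nonneg d.2]
      · rw [Real.norm_eq_abs, sq_abs]
        nlinarith [sq_nonneg ‖d.1‖]
    rw [hn]
    nlinarith
  have h5 : 1 / (4 * B) * ‖p - q‖ ^ 2 ≤ c * ∫ z, predict d z ^ 2 ∂Q + l * ‖d.1‖ ^ 2 := by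
    rw [one_div, ← div_eq_inv_mul, div_le_iff₀ (by positivity)]
    nlinarith
  unfold penRisk
  nlinarith

theorem exists_unique_penRisk_min (hB : Bounds K w c M)
    (hy : Integrable (fun z : X × ℝ => z.2 ^ 2) Q) (hl : 0 < l) (hQ : 0 < Q.real Set.univ) :
    ∃! q : K.Space × ℝ, ∀ q' : K.Space × ℝ, penRisk w Q l q ≤ penRisk w Q l q' := by
  have hc := hB.c_pos
  have hpos : 0 < 1 / (4 * (2 / (Q.real Set.univ * c) + (2 * M ^ 2 + 1) / l)) := by positivity
  obtain ⟨q, hq⟩ := exists_forall_le_of_midpoint (hB.continuous_penRisk hy (l := l))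
    (fun q => add_nonneg (hB.risk_nonneg q) (by positivity)) hpos
    (hB.penRisk_midpoint hy hl hQ)
  exact ⟨q, hq, fun p hp => eq_of_forall_le_of_midpoint hpos (hB.penRisk_midpoint hy hl hQ) hp hq⟩

/-- First-order condition without differentiating under the integral: minimality and the upper
quadratic bound along `q + t • v` give a quadratic in `t` that is nonnegative and vanishes at `0`,
so its linear coefficient is zero. -/
theorem integral_score_mul_predict (hB : Bounds K w c M)
    (hy : Integrable (fun z : X × ℝ => z.2 ^ 2) Q) {q : K.Space × ℝ}
    (hq : ∀ q' : K.Space × ℝ, penRisk w Q l q ≤ penRisk w Q l q') (v : K.Space × ℝ) :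
    ∫ z, score w q z * predict v z ∂Q = 2 * l * ⟪q.1, v.1⟫ := by
  have h : 2 * l * ⟪q.1, v.1⟫ - ∫ z, score w q z * predict v z ∂Q = 0 := by
    refine eq_zero_of_forall_mul_add_sq_nonneg
      (b := ∫ z, predict v z ^ 2 ∂Q + l * ‖v.1‖ ^ 2) fun t => ?_
    have h1 := hq (q + t • v)
    have h2 := hB.risk_add_le hy q (t • v)
    have e1 : ∫ z, score w q z * predict (t • v) z ∂Q =
        t * ∫ z, score w q z * predict v z ∂Q := by
      rw [← integral_const_mul]
      refine integral_congr_ae (ae_of_all _ fun z => ?_)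
      simp only [predict_smul]
      ring
    have e2 : ∫ z, predict (t • v) z ^ 2 ∂Q = t ^ 2 * ∫ z, predict v z ^ 2 ∂Q := by
      rw [← integral_const_mul]
      refine integral_congr_ae (ae_of_all _ fun z => ?_)
      simp only [predict_smul]
      ring
    have e3 := norm_add_sq_fst q (t • v)
    rw [Prod.smul_fst, real_inner_smul_right, norm_smul, mul_pow, Real.norm_eq_abs, sq_abs] at e3
    unfold penRisk at h1
    rw [e3] at h1
    rw [e1, e2] at h2
    linarith
  linarith

end Bounds

end PenalizedRisk

/-! ### The estimator and its measurability -/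

section Estimator

variable {X : Type*} [MeasurableSpace X] {K : PosDefKernel X} {w c M l : ℝ} {n : ℕ}

/-- The (unnormalized) empirical measure of a data set. -/
noncomputable def empirical (d : Fin n → X × ℝ) : Measure (X × ℝ) := ∑ i, Measure.dirac (d i)

instance (d : Fin n → X × ℝ) : IsFiniteMeasure (empirical d) := by
  unfold empirical; infer_instance

theorem integrable_empirical (d : Fin n → X × ℝ) {g : X × ℝ → ℝ} (hg : Measurable g) :
    Integrable g (empirical d) :=
  integrable_finsetSum_measure.2 fun i _ => integrable_dirac' hg.stronglyMeasurable (by simp)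

theorem integral_empirical (d : Fin n → X × ℝ) {g : X × ℝ → ℝ} (hg : Measurable g) :
    ∫ z, g z ∂(empirical d) = ∑ i, g (d i) := by
  rw [empirical, integral_finsetSum_measure fun i _ =>
    integrable_dirac' hg.stronglyMeasurable (by simp)]
  exact Finset.sum_congr rfl fun i _ => integral_dirac' _ _ hg.stronglyMeasurable

theorem empirical_real_univ (d : Fin n → X × ℝ) : (empirical d).real Set.univ = n := by
  have := integral_empirical d (g := fun _ => 1) measurable_const
  simpa using this

theorem integrable_sq_empirical (d : Fin n → X × ℝ) :
    Integrable (fun z : X × ℝ => z.2 ^ 2) (empirical d) :=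
  integrable_empirical d (by fun_prop)

/-- One step of gradient descent for the penalized empirical objective. -/
noncomputable def gradStep (w l η : ℝ) (d : Fin n → X × ℝ) (q : K.Space × ℝ) : K.Space × ℝ :=
  (q.1 + η • (∑ i, score w q (d i) • K.feature (d i).1 - (2 * l) • q.1),
    q.2 + η * ∑ i, score w q (d i))

/-- A family `F` of pairs `(f, a)` is jointly measurable if both `(d, x) ↦ (F d).1 x` and
`d ↦ (F d).2` are measurable. -/
structure JointlyMeasurable {D : Type*} [MeasurableSpace D] (F : D → K.Space × ℝ) : Prop where
  fst : Measurable fun p : D × X => (F p.1).1 p.2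
  snd : Measurable fun d => (F d).2

namespace JointlyMeasurable

variable {D : Type*} [MeasurableSpace D] {F : D → K.Space × ℝ}

theorem eval {E : Type*} [MeasurableSpace E] (hF : JointlyMeasurable F) {g : E → D} {x : E → X}
    (hg : Measurable g) (hx : Measurable x) : Measurable fun e => (F (g e)).1 (x e) := by
  have h : ∀ φ : D × X → ℝ, Measurable φ → Measurable fun e => φ (g e, x e) :=
    fun φ hφ => hφ.comp (hg.prodMk hx)
  exact h (fun p => (F p.1).1 p.2) hF.fst

theorem of_tendsto {G : ℕ → D → K.Space × ℝ} (hG : ∀ k, JointlyMeasurable (G k))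
    (h : ∀ d, Tendsto (fun k => G k d) atTop (𝓝 (F d))) : JointlyMeasurable F := by
  constructor
  · refine measurable_of_tendsto_metrizable (fun k => (hG k).fst)
      (tendsto_pi_nhds.2 fun p => ?_)
    have h1 : Tendsto (fun k => (G k p.1).1) atTop (𝓝 (F p.1).1) :=
      (continuous_fst.tendsto _).comp (h p.1)
    exact ((RKHS.continuous_eval p.2).tendsto _).comp h1
  · exact measurable_of_tendsto_metrizable (fun k => (hG k).snd)
      (tendsto_pi_nhds.2 fun d => (continuous_snd.tendsto _).comp (h d))

theorem measurable_risk (hF : JointlyMeasurable F) (P : Measure (X × ℝ)) [SFinite P] :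
    Measurable fun d => risk w P (F d).1 (F d).2 := by
  have h1 : Measurable fun p : D × (X × ℝ) => (F p.1).1 p.2.1 :=
    hF.eval measurable_fst (measurable_fst.comp measurable_snd)
  have h2 : Measurable fun p : D × (X × ℝ) => loss w (p.2.2 - (F p.1).2 - (F p.1).1 p.2.1) :=
    measurable_loss.comp (((measurable_snd.comp measurable_snd).sub
      (hF.snd.comp measurable_fst)).sub h1)
  exact (h2.stronglyMeasurable.integral_prod_right' (ν := P)).measurable

end JointlyMeasurable

namespace Bounds

theorem objective_eq (hB : Bounds K w c M) (d : Fin n → X × ℝ) (q : K.Space × ℝ) :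
    objective w K l d q = penRisk w (empirical d) l q := by
  rw [objective, penRisk, risk,
    integral_empirical d (g := fun z => loss w (z.2 - q.2 - q.1 z.1))
      (measurable_loss.comp (hB.measurable_residual q))]

theorem isMinimizer_iff (hB : Bounds K w c M) (d : Fin n → X × ℝ) (q : K.Space × ℝ) :
    IsMinimizer w K l d q ↔
      ∀ q' : K.Space × ℝ, penRisk w (empirical d) l q ≤ penRisk w (empirical d) l q' := by
  simp only [IsMinimizer, hB.objective_eq]

theorem existsUnique_isMinimizer (hB : Bounds K w c M) (hn : 1 ≤ n) (hl : 0 < l)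
    (d : Fin n → X × ℝ) : ∃! q : K.Space × ℝ, IsMinimizer w K l d q := by
  simp only [hB.isMinimizer_iff]
  refine hB.exists_unique_penRisk_min (integrable_sq_empirical d) hl ?_
  rw [empirical_real_univ]
  exact_mod_cast hn

theorem isMinimizer_estimator (hB : Bounds K w c M) (hn : 1 ≤ n) (hl : 0 < l)
    (d : Fin n → X × ℝ) : IsMinimizer w K l d (estimator w K l d) :=
  Classical.epsilon_spec (hB.existsUnique_isMinimizer hn hl d).exists

theorem sum_score_mul_predict (hB : Bounds K w c M) {d : Fin n → X × ℝ} {q : K.Space × ℝ}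
    (hq : IsMinimizer w K l d q) (v : K.Space × ℝ) :
    ∑ i, score w q (d i) * predict v (d i) = 2 * l * ⟪q.1, v.1⟫ := by
  rw [← hB.integral_score_mul_predict (integrable_sq_empirical d) ((hB.isMinimizer_iff d q).1 hq) v,
    integral_empirical d (g := fun z => score w q z * predict v z)
      ((hB.measurable_score q).mul (hB.measurable_predict v))]

/-- The gradient is strongly monotone and Lipschitz, so a short step contracts towards its zero. The
distance is the Hilbert one, `‖f‖ ^ 2 + a ^ 2`, not the sup norm of the product. -/
theorem gradStep_contracts (hB : Bounds K w c M) (hn : 1 ≤ n) (hl : 0 < l) :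
    ∃ η ρ : ℝ, 0 ≤ ρ ∧ ρ < 1 ∧ ∀ (d : Fin n → X × ℝ) (p q : K.Space × ℝ),
      IsMinimizer w K l d q →
      ‖(gradStep w l η d p - q).1‖ ^ 2 + (gradStep w l η d p - q).2 ^ 2 ≤
        ρ * (‖(p - q).1‖ ^ 2 + (p - q).2 ^ 2) := by
  have hc := hB.c_pos
  have hn' : (0 : ℝ) < n := by exact_mod_cast hn
  -- With `D = c U + l ‖v.1‖ ^ 2`, the squared gradient difference is at most `2 L D`, its inner
  -- product with `v` is at least `2 D`, and the squared distance is at most `B D`. The step `1 / L`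
  -- thus gains `2 D / L`, a fraction `2 / (L B)` of the squared distance.
  set L : ℝ := (2 * n + 4 * n * M ^ 2) / c + 4 * l with hL
  set B : ℝ := 2 / (n * c) + (2 * M ^ 2 + 1) / l with hBdef
  have hLpos : 0 < L := by positivity
  have hBpos : 0 < B := by positivity
  refine ⟨1 / L, max 0 (1 - 2 / (L * B)), le_max_left _ _,
    max_lt one_pos (sub_lt_self _ (by positivity)), fun d p q hq => ?_⟩
  set v := p - q with hv
  set e : Fin n → ℝ := fun i => score w p (d i) - score w q (d i) with he
  set u : Fin n → ℝ := fun i => predict v (d i) with hu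
  have hres : ∀ i, (d i).2 - p.2 - p.1 (d i).1 - ((d i).2 - q.2 - q.1 (d i).1) = -u i := fun i => by
    simp only [hu, hv, predict, Prod.snd_sub, Prod.fst_sub, RKHS.coe_sub, Pi.sub_apply]
    ring
  have hcoer : ∀ i, e i * u i ≤ -(2 * c * u i ^ 2) := fun i => by
    have := le_slope_sub_mul hB.c_le hB.c_le' ((d i).2 - p.2 - p.1 (d i).1)
      ((d i).2 - q.2 - q.1 (d i).1)
    rw [hres] at this
    simp only [he, score]
    nlinarith
  have hlip : ∀ i, e i ^ 2 ≤ 4 * u i ^ 2 := fun i => by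
    have := abs_slope_sub_le hB.w_pos hB.w_lt_one ((d i).2 - p.2 - p.1 (d i).1)
      ((d i).2 - q.2 - q.1 (d i).1)
    rw [hres, abs_neg] at this
    have h2 : |e i| ^ 2 ≤ (2 * |u i|) ^ 2 := pow_le_pow_left₀ (abs_nonneg _) this 2
    rw [mul_pow, sq_abs, sq_abs] at h2
    linarith
  -- The gradient vanishes at `q`, so the gradient at `p` is a difference of gradients.
  have hs0 : ∑ i, score w q (d i) = 0 := by
    simpa [predict] using hB.sum_score_mul_predict hq (0, 1)
  have hs1 : ∑ i, score w q (d i) • K.feature (d i).1 = (2 * l) • q.1 := by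
    refine ext_inner_right ℝ fun h => ?_
    rw [sum_inner, real_inner_smul_left, ← hB.sum_score_mul_predict hq (h, 0)]
    refine Finset.sum_congr rfl fun i _ => ?_
    rw [real_inner_smul_left, real_inner_comm, inner_feature]
    simp [predict]
  set G : K.Space := ∑ i, e i • K.feature (d i).1 with hG
  set S : ℝ := ∑ i, e i with hS
  have hsnd : (gradStep w l (1 / L) d p - q).2 = v.2 + 1 / L * S := by
    simp only [gradStep, hS, he, Finset.sum_sub_distrib, hs0, sub_zero, hv, Prod.snd_sub]
    ring
  have hfst : (gradStep w l (1 / L) d p - q).1 = v.1 + (1 / L) • (G - (2 * l) • v.1) := by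
    simp only [gradStep, hG, he, sub_smul, Finset.sum_sub_distrib, hs1, hv, Prod.fst_sub]
    module
  set U : ℝ := ∑ i, u i ^ 2 with hU
  have hE : ∑ i, e i ^ 2 ≤ 4 * U := by
    rw [hU, Finset.mul_sum]
    exact Finset.sum_le_sum fun i _ => hlip i
  have hSU : S ^ 2 ≤ n * (4 * U) := by
    refine (sq_sum_le_card_mul_sum_sq (s := Finset.univ) (f := e)).trans ?_
    rw [Finset.card_univ, Fintype.card_fin]
    exact mul_le_mul_of_nonneg_left hE hn'.le
  have hGU : ‖G‖ ^ 2 ≤ n * (4 * U) * M ^ 2 := by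
    have h1 : ‖G‖ ≤ (∑ i, |e i|) * M := by
      refine (norm_sum_le _ _).trans ?_
      rw [Finset.sum_mul]
      refine Finset.sum_le_sum fun i _ => ?_
      rw [norm_smul, Real.norm_eq_abs]
      exact mul_le_mul_of_nonneg_left (norm_feature_le hB.M_nonneg hB.diag_le _) (abs_nonneg _)
    have h2 : (∑ i, |e i|) ^ 2 ≤ n * (4 * U) := by
      refine (sq_sum_le_card_mul_sum_sq (s := Finset.univ) (f := fun i => |e i|)).trans ?_
      rw [Finset.card_univ, Fintype.card_fin]
      simp only [sq_abs]
      exact mul_le_mul_of_nonneg_left hE hn'.le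
    refine (pow_le_pow_left₀ (norm_nonneg _) h1 2).trans ?_
    rw [mul_pow]
    exact mul_le_mul_of_nonneg_right h2 (sq_nonneg M)
  have hcross : v.2 * S + ⟪v.1, G⟫ ≤ -(2 * c * U) := by
    have : v.2 * S + ⟪v.1, G⟫ = ∑ i, e i * u i := by
      rw [hG, hS, inner_sum, Finset.mul_sum, ← Finset.sum_add_distrib]
      refine Finset.sum_congr rfl fun i _ => ?_
      rw [real_inner_smul_right, inner_feature]
      simp only [hu, predict]
      ring
    rw [this, hU, Finset.mul_sum, ← Finset.sum_neg_distrib]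
    exact Finset.sum_le_sum fun i _ => hcoer i
  have hgrad : ‖G - (2 * l) • v.1‖ ^ 2 ≤ 2 * ‖G‖ ^ 2 + 8 * l ^ 2 * ‖v.1‖ ^ 2 := by
    have h1 := norm_sub_le G ((2 * l) • v.1)
    rw [norm_smul, Real.norm_of_nonneg (by positivity)] at h1
    refine (pow_le_pow_left₀ (norm_nonneg _) h1 2).trans ?_
    nlinarith [sq_nonneg (‖G‖ - 2 * l * ‖v.1‖)]
  have hexp : ‖v.1 + (1 / L) • (G - (2 * l) • v.1)‖ ^ 2 = ‖v.1‖ ^ 2 +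
      2 * (1 / L) * (⟪v.1, G⟫ - 2 * l * ‖v.1‖ ^ 2) + (1 / L) ^ 2 * ‖G - (2 * l) • v.1‖ ^ 2 := by
    rw [norm_add_sq_real, real_inner_smul_right, inner_sub_right, real_inner_smul_right,
      real_inner_self_eq_norm_sq, norm_smul, Real.norm_of_nonneg (by positivity)]
    ring
  have hD := hB.norm_sq_add_sq_le (Q := empirical d) (by rw [empirical_real_univ]; exact hn') hl v
  rw [empirical_real_univ, integral_empirical d ((hB.measurable_predict v).pow_const 2)] at hD
  change _ ≤ B * (c * U + l * ‖v.1‖ ^ 2) at hD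
  rw [hsnd, hfst, hexp]
  have hUn : 0 ≤ U := Finset.sum_nonneg fun i _ => sq_nonneg _
  set D : ℝ := c * U + l * ‖v.1‖ ^ 2 with hDdef
  have hq2 : S ^ 2 + ‖G - (2 * l) • v.1‖ ^ 2 ≤ L * (2 * D) := by
    have : L * (2 * D) = 4 * n * U + 8 * n * M ^ 2 * U + 8 * l ^ 2 * ‖v.1‖ ^ 2 +
        ((2 * n + 4 * n * M ^ 2) / c * (2 * (l * ‖v.1‖ ^ 2)) + 4 * l * (2 * (c * U))) := by
      rw [hL, hDdef]
      field_simp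
      ring
    have h2 : 0 ≤ (2 * n + 4 * n * M ^ 2) / c * (2 * (l * ‖v.1‖ ^ 2)) + 4 * l * (2 * (c * U)) := by
      positivity
    nlinarith
  have hstep : ‖v.1‖ ^ 2 + 2 * (1 / L) * (⟪v.1, G⟫ - 2 * l * ‖v.1‖ ^ 2) +
      (1 / L) ^ 2 * ‖G - (2 * l) • v.1‖ ^ 2 + (v.2 + 1 / L * S) ^ 2 ≤
      ‖v.1‖ ^ 2 + v.2 ^ 2 - 1 / L * (2 * D) := by
    have h1 : (1 / L) ^ 2 * (S ^ 2 + ‖G - (2 * l) • v.1‖ ^ 2) ≤ 1 / L * (2 * D) := by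
      refine (mul_le_mul_of_nonneg_left hq2 (by positivity)).trans_eq ?_
      field_simp
    have h2 : 2 * (1 / L) * (v.2 * S + ⟪v.1, G⟫ - 2 * l * ‖v.1‖ ^ 2) ≤
        2 * (1 / L) * (-(2 * D)) :=
      mul_le_mul_of_nonneg_left (by rw [hDdef]; linarith) (by positivity)
    linarith
  refine hstep.trans ?_
  have h3 : 2 / (L * B) * (‖v.1‖ ^ 2 + v.2 ^ 2) ≤ 1 / L * (2 * D) := by
    refine (mul_le_mul_of_nonneg_left hD (by positivity)).trans_eq ?_
    field_simp
  have h4 : (1 - 2 / (L * B)) * (‖v.1‖ ^ 2 + v.2 ^ 2) ≤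
      max 0 (1 - 2 / (L * B)) * (‖v.1‖ ^ 2 + v.2 ^ 2) :=
    mul_le_mul_of_nonneg_right (le_max_right _ _) (by positivity)
  linarith

/-- One step size serves all data sets, so that each iterate is a single explicit function of `d`.
-/
theorem exists_tendsto_estimator (hB : Bounds K w c M) (hn : 1 ≤ n) (hl : 0 < l) :
    ∃ η : ℝ, ∀ d : Fin n → X × ℝ,
      Tendsto (fun k => (gradStep w l η d)^[k] (0 : K.Space × ℝ)) atTop
        (𝓝 (estimator w K l d)) := by
  obtain ⟨η, ρ, hρ0, hρ1, h⟩ := hB.gradStep_contracts hn hl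
  refine ⟨η, fun d => ?_⟩
  set q := estimator w K l d
  have hq : IsMinimizer w K l d q := hB.isMinimizer_estimator hn hl d
  set x : ℕ → K.Space × ℝ := fun k => (gradStep w l η d)^[k] 0
  have hgeo : ∀ k, ‖(x k - q).1‖ ^ 2 + (x k - q).2 ^ 2 ≤
      ρ ^ k * (‖(x 0 - q).1‖ ^ 2 + (x 0 - q).2 ^ 2) := by
    intro k
    induction k with
    | zero => simp
    | succ k ih =>
      have h1 := h d (x k) q hq
      have h2 : x (k + 1) = gradStep w l η d (x k) := Function.iterate_succ_apply' _ _ _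
      rw [h2, pow_succ' ρ k, mul_assoc]
      exact h1.trans (mul_le_mul_of_nonneg_left ih hρ0)
  have hlim : Tendsto (fun k => ‖(x k - q).1‖ ^ 2 + (x k - q).2 ^ 2) atTop (𝓝 0) := by
    refine squeeze_zero (fun k => by positivity) hgeo ?_
    simpa using (tendsto_pow_atTop_nhds_zero_of_lt_one hρ0 hρ1).mul_const
      (‖(x 0 - q).1‖ ^ 2 + (x 0 - q).2 ^ 2)
  have hsqrt := hlim.sqrt
  rw [Real.sqrt_zero] at hsqrt
  refine tendsto_iff_norm_sub_tendsto_zero.2 (squeeze_zero (fun k => norm_nonneg _) (fun k => ?_)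
    hsqrt)
  rw [Prod.norm_def]
  refine max_le (Real.le_sqrt_of_sq_le ?_) (Real.le_sqrt_of_sq_le ?_)
  · linarith [sq_nonneg (x k - q).2]
  · rw [Real.norm_eq_abs, sq_abs]
    linarith [sq_nonneg ‖(x k - q).1‖]

/-- By the reproducing property, the step evaluated at `x` is a real expression in scores and kernel
values; no measurable structure on `K.Space` intervenes. -/
theorem jointlyMeasurable_gradStep (hB : Bounds K w c M) (η : ℝ)
    {F : (Fin n → X × ℝ) → K.Space × ℝ} (hF : JointlyMeasurable F) :
    JointlyMeasurable fun d => gradStep w l η d (F d) := by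
  have hscore : ∀ i : Fin n, Measurable fun d : Fin n → X × ℝ => score w (F d) (d i) := fun i =>
    measurable_slope.comp ((measurable_snd.comp (measurable_pi_apply i)).sub hF.snd |>.sub
      (hF.eval measurable_id (measurable_fst.comp (measurable_pi_apply i))))
  constructor
  · have : (fun p : (Fin n → X × ℝ) × X => (gradStep w l η p.1 (F p.1)).1 p.2) =
        fun p => (F p.1).1 p.2 + η * (∑ i, score w (F p.1) (p.1 i) * K p.2 (p.1 i).1 -
          2 * l * (F p.1).1 p.2) := by
      ext p
      rw [← inner_feature, gradStep]
      simp only [inner_add_left, real_inner_smul_left, inner_sub_left, sum_inner, inner_feature,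
        feature_apply]
    rw [this]
    refine hF.fst.add (((Finset.measurable_fun_sum _ fun i _ => ?_).sub
      (hF.fst.const_mul _)).const_mul _)
    have h1 : Measurable fun p : (Fin n → X × ℝ) × X => (p.2, (p.1 i).1) :=
      measurable_snd.prodMk
        (measurable_fst.comp ((measurable_pi_apply i).comp measurable_fst))
    have h2 : Measurable fun p : (Fin n → X × ℝ) × X => K p.2 (p.1 i).1 := hB.meas.comp h1
    exact ((hscore i).comp measurable_fst).mul h2
  · exact hF.snd.add ((Finset.measurable_fun_sum _ fun i _ => hscore i).const_mul _)

theorem jointlyMeasurable_iterate_gradStep (hB : Bounds K w c M) (η : ℝ) (k : ℕ) :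
    JointlyMeasurable fun d : Fin n → X × ℝ => (gradStep w l η d)^[k] (0 : K.Space × ℝ) := by
  induction k with
  | zero =>
    refine ⟨?_, measurable_const⟩
    simp only [Function.iterate_zero, id_eq, Prod.fst_zero, RKHS.coe_zero]
    exact measurable_const
  | succ k ih =>
    simp only [Function.iterate_succ_apply']
    exact hB.jointlyMeasurable_gradStep η ih

theorem jointlyMeasurable_estimator (hB : Bounds K w c M) (hn : 1 ≤ n) (hl : 0 < l) :
    JointlyMeasurable fun d : Fin n → X × ℝ => estimator w K l d := by
  obtain ⟨η, hη⟩ := hB.exists_tendsto_estimator hn hl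
  exact JointlyMeasurable.of_tendsto (fun k => hB.jointlyMeasurable_iterate_gradStep η k) hη

theorem measurable_observedRisk (hB : Bounds K w c M) (P : Measure (X × ℝ)) [SFinite P]
    (hn : 1 ≤ n) (hl : 0 < l) :
    Measurable fun d : Fin n → X × ℝ => observedRisk w P K l d :=
  (hB.jointlyMeasurable_estimator hn hl).measurable_risk P

end Bounds

end Estimator

/-! ### Comparison of the estimator with the population minimizer -/

/-- Here `b` and `H` are the sizes of the intercept and function parts of `v`, `s` its absolute mean
prediction, `B` and `G` the normalized gradients. Curvature controls `s` rather than `b`, so `b` is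
replaced by `s + M H`; completing squares then gives `c s ^ 2 + l H ^ 2 ≤ V`. -/
theorem sq_le_of_curvature {c l M b s H B G : ℝ} (hc : 0 < c) (hl : 0 < l) (hM : 0 ≤ M)
    (hb : 0 ≤ b) (hH : 0 ≤ H) (hB : 0 ≤ B) (hbs : b ≤ s + M * H)
    (h : c * s ^ 2 + l * H ^ 2 ≤ b * B + G * H) :
    l * H ^ 2 + (b + M * H) ^ 2 ≤
      (1 + 2 / c + 8 * M ^ 2 / l) * ((1 / c + 2 * M ^ 2 / l) * B ^ 2 + 2 / l * G ^ 2) := by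
  set V := (1 / c + 2 * M ^ 2 / l) * B ^ 2 + 2 / l * G ^ 2 with hV
  have h1 : b * B ≤ s * B + M * H * B := by nlinarith
  have h2 : s * B ≤ c * s ^ 2 / 2 + B ^ 2 / (2 * c) := by
    have : c * s ^ 2 / 2 + B ^ 2 / (2 * c) - s * B = (c * s - B) ^ 2 / (2 * c) := by
      field_simp; ring
    have : 0 ≤ (c * s - B) ^ 2 / (2 * c) := by positivity
    linarith
  have h3 : (M * B + G) * H ≤ l * H ^ 2 / 2 + (M * B + G) ^ 2 / (2 * l) := by
    have : l * H ^ 2 / 2 + (M * B + G) ^ 2 / (2 * l) - (M * B + G) * H =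
        (l * H - (M * B + G)) ^ 2 / (2 * l) := by
      field_simp; ring
    have : 0 ≤ (l * H - (M * B + G)) ^ 2 / (2 * l) := by positivity
    linarith
  have h4 : B ^ 2 / (2 * c) + (M * B + G) ^ 2 / (2 * l) ≤ V / 2 := by
    have : V / 2 - (B ^ 2 / (2 * c) + (M * B + G) ^ 2 / (2 * l)) = (M * B - G) ^ 2 / (2 * l) := by
      rw [hV]; field_simp; ring
    have : 0 ≤ (M * B - G) ^ 2 / (2 * l) := by positivity
    linarith
  have h5 : c * s ^ 2 + l * H ^ 2 ≤ V := by linarith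
  have h6 : s ^ 2 ≤ V / c := by
    rw [le_div_iff₀' hc]; nlinarith [mul_nonneg hl.le (sq_nonneg H)]
  have h7 : H ^ 2 ≤ V / l := by
    rw [le_div_iff₀' hl]; nlinarith [mul_nonneg hc.le (sq_nonneg s)]
  have h8 : (b + M * H) ^ 2 ≤ 2 * s ^ 2 + 8 * M ^ 2 * H ^ 2 := by
    have : (b + M * H) ^ 2 ≤ (s + 2 * (M * H)) ^ 2 :=
      pow_le_pow_left₀ (by positivity) (by linarith) 2
    nlinarith [sq_nonneg (s - 2 * (M * H))]
  have h9 : l * H ^ 2 ≤ V := by nlinarith [mul_nonneg hc.le (sq_nonneg s)]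
  have h10 : (1 + 2 / c + 8 * M ^ 2 / l) * V = V + 2 * (V / c) + 8 * M ^ 2 * (V / l) := by ring
  rw [h10]
  have := mul_le_mul_of_nonneg_left h7 (by positivity : 0 ≤ 8 * M ^ 2)
  linarith

section Comparison

variable {X : Type*} {K : PosDefKernel X} {w c M l lam : ℝ} {n : ℕ}

/-- The sum over the data of the scores of `q`. -/
noncomputable def scoreSum (w : ℝ) (d : Fin n → X × ℝ) (q : K.Space × ℝ) : ℝ :=
  ∑ i, score w q (d i)

/-- Minus the gradient in `f` at `q` of the penalized empirical objective. -/
noncomputable def gradFst (w lam : ℝ) (d : Fin n → X × ℝ) (q : K.Space × ℝ) : K.Space :=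
  ∑ i, score w q (d i) • K.feature (d i).1 - (2 * lam) • q.1

/-- Reduces the second moment of an `H_K`-valued sum to integrals of real functions. -/
theorem norm_gradFst_sq (d : Fin n → X × ℝ) (q : K.Space × ℝ) :
    ‖gradFst w lam d q‖ ^ 2 =
      ∑ i, ∑ j, score w q (d i) * score w q (d j) * K (d i).1 (d j).1 -
        4 * lam * ∑ i, score w q (d i) * q.1 (d i).1 + 4 * lam ^ 2 * ‖q.1‖ ^ 2 := by
  rw [gradFst, norm_sub_sq_real, norm_smul, mul_pow, Real.norm_eq_abs, sq_abs,
    real_inner_smul_right, sum_inner, ← real_inner_self_eq_norm_sq, sum_inner]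
  simp only [inner_sum, real_inner_smul_left, real_inner_smul_right]
  have h1 : ∀ i j, ⟪K.feature (d i).1, K.feature (d j).1⟫ = K (d i).1 (d j).1 := fun i j => by
    rw [inner_feature, feature_apply, K.symm]
  have h2 : ∀ i, ⟪K.feature (d i).1, q.1⟫ = q.1 (d i).1 := fun i => by
    rw [real_inner_comm, inner_feature]
  simp only [h1, h2]
  have h3 : ∀ i j, score w q (d j) * (score w q (d i) * K (d i).1 (d j).1) =
      score w q (d i) * score w q (d j) * K (d i).1 (d j).1 := fun i j => by ring
  simp only [h3]
  ring

/-- The factor `1` is a constant kernel, so the same double-sum estimate applies. -/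
theorem scoreSum_sq (d : Fin n → X × ℝ) (q : K.Space × ℝ) :
    scoreSum w d q ^ 2 = ∑ i, ∑ j, score w q (d i) * score w q (d j) * 1 := by
  simp only [scoreSum, sq, Finset.sum_mul_sum, mul_one]

variable [MeasurableSpace X]

namespace Bounds

/-- The estimator does at least as well as `q` on the objective; the lower quadratic expansion at
`q` leaves the curvature terms bounded by the linear ones. -/
theorem curvature_estimator_sub_le (hB : Bounds K w c M) (hn : 1 ≤ n) (hlam : 0 < lam)
    (d : Fin n → X × ℝ) (q : K.Space × ℝ) :
    c * ∑ i, predict (estimator w K lam d - q) (d i) ^ 2 +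
        lam * ‖(estimator w K lam d - q).1‖ ^ 2 ≤
      (estimator w K lam d - q).2 * scoreSum w d q +
        ⟪gradFst w lam d q, (estimator w K lam d - q).1⟫ := by
  set v := estimator w K lam d - q with hv
  have hp : estimator w K lam d = q + v := by rw [hv, add_sub_cancel]
  have h1 := (hB.isMinimizer_iff d _).1 (hB.isMinimizer_estimator hn hlam d) q
  have h2 := hB.le_risk_add (integrable_sq_empirical d) q v
  rw [hp] at h1
  unfold penRisk at h1
  rw [norm_add_sq_fst] at h1
  rw [integral_empirical d (g := fun z => score w q z * predict v z)
      ((hB.measurable_score q).mul (hB.measurable_predict v)),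
    integral_empirical d ((hB.measurable_predict v).pow_const 2)] at h2
  have h3 : ∑ i, score w q (d i) * predict v (d i) - 2 * lam * ⟪q.1, v.1⟫ =
      v.2 * scoreSum w d q + ⟪gradFst w lam d q, v.1⟫ := by
    rw [gradFst, scoreSum, inner_sub_left, sum_inner, real_inner_smul_left, Finset.mul_sum]
    rw [← add_sub_assoc, ← Finset.sum_add_distrib]
    congr 1
    refine Finset.sum_congr rfl fun i _ => ?_
    rw [real_inner_smul_left, real_inner_comm, inner_feature, predict]
    ring
  linarith

theorem observedRisk_le (hB : Bounds K w c M) {P : Measure (X × ℝ)} [IsProbabilityMeasure P]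
    (hy : Integrable (fun z : X × ℝ => z.2 ^ 2) P) (hn : 1 ≤ n) (hl : 0 < l)
    {q : K.Space × ℝ} (hq : ∀ q' : K.Space × ℝ, penRisk w P l q ≤ penRisk w P l q')
    (d : Fin n → X × ℝ) :
    observedRisk w P K (n * l) d ≤ penRisk w P l q +
      (1 + 2 / c + 8 * M ^ 2 / l) * ((1 / c + 2 * M ^ 2 / l) * (scoreSum w d q ^ 2 / n ^ 2) +
        2 / l * (‖gradFst w (n * l) d q‖ ^ 2 / n ^ 2)) := by
  have hn' : (0 : ℝ) < n := by exact_mod_cast hn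
  have hcurv := hB.curvature_estimator_sub_le hn (mul_pos hn' hl) d q
  set v := estimator w K (n * l) d - q with hv
  have hp : estimator w K (n * l) d = q + v := by rw [hv, add_sub_cancel]
  have h1 := hB.risk_add_le hy q v
  rw [hB.integral_score_mul_predict hy hq] at h1
  have h2 := hB.integral_predict_sq_le (Q := P) v
  rw [probReal_univ, mul_one] at h2
  -- The term `l * ‖q.1‖ ^ 2` completes the risk of `q` to `penRisk w P l q`; the rest is absorbed
  -- by the curvature bound.
  have h3 : -(2 * l * ⟪q.1, v.1⟫) ≤ l * ‖q.1‖ ^ 2 + l * ‖v.1‖ ^ 2 := by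
    have : 0 ≤ l * ‖q.1 + v.1‖ ^ 2 := by positivity
    rw [norm_add_sq_real] at this
    linarith
  -- By Cauchy–Schwarz only the mean prediction over the sample is kept: with `‖v.1‖` it already
  -- controls the intercept.
  have hS : c * (|∑ i, predict v (d i)| / n) ^ 2 ≤ c * (∑ i, predict v (d i) ^ 2) / n := by
    have := sq_sum_le_card_mul_sum_sq (s := Finset.univ) (f := fun i => predict v (d i))
    rw [Finset.card_univ, Fintype.card_fin] at this
    rw [div_pow, sq_abs, mul_div_assoc]
    refine mul_le_mul_of_nonneg_left ?_ hB.c_pos.le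
    rw [div_le_div_iff₀ (by positivity) hn']
    nlinarith
  have hb : |v.2| ≤ |∑ i, predict v (d i)| / n + M * ‖v.1‖ := by
    have e : v.2 = (∑ i, predict v (d i)) / n - (∑ i, v.1 (d i).1) / n := by
      simp only [predict, Finset.sum_add_distrib, Finset.sum_const, Finset.card_univ,
        Fintype.card_fin, nsmul_eq_mul]
      field_simp
      ring
    have h5 : |(∑ i, v.1 (d i).1) / n| ≤ M * ‖v.1‖ := by
      rw [abs_div, abs_of_pos hn', div_le_iff₀ hn']
      refine (Finset.abs_sum_le_sum_abs _ _).trans ((Finset.sum_le_sum fun i _ =>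
        abs_apply_le hB.M_nonneg hB.diag_le v.1 (d i).1).trans_eq ?_)
      simp [mul_comm]
    calc |v.2| = |(∑ i, predict v (d i)) / n - (∑ i, v.1 (d i).1) / n| := by rw [← e]
      _ ≤ |(∑ i, predict v (d i)) / n| + |(∑ i, v.1 (d i).1) / n| := abs_sub _ _
      _ ≤ _ := by rw [abs_div, abs_of_pos hn']; linarith
  have hmain := sq_le_of_curvature (c := c) (l := l) (M := M) (b := |v.2|)
    (s := |∑ i, predict v (d i)| / n) (H := ‖v.1‖) (B := |scoreSum w d q| / n)
    (G := ‖gradFst w (n * l) d q‖ / n) hB.c_pos hl hB.M_nonneg (abs_nonneg _)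
    (norm_nonneg _) (by positivity) hb (by
      have h6 : v.2 * scoreSum w d q ≤ |v.2| * |scoreSum w d q| := by
        rw [← abs_mul]; exact le_abs_self _
      have h7 := real_inner_le_norm (gradFst w (n * l) d q) v.1
      have h8 : (c * ∑ i, predict v (d i) ^ 2) / n + l * ‖v.1‖ ^ 2 ≤
          (|v.2| * |scoreSum w d q| + ‖gradFst w (n * l) d q‖ * ‖v.1‖) / n := by
        rw [le_div_iff₀ hn', add_mul, div_mul_cancel₀ _ hn'.ne']
        linarith
      refine (add_le_add_left hS _).trans (h8.trans_eq ?_)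
      ring)
  rw [div_pow, div_pow, sq_abs] at hmain
  rw [observedRisk, hp, penRisk]
  linarith

end Bounds

end Comparison

/-! ### Second moments of double sums over an i.i.d. sample -/

section Sample

variable {X : Type*} [MeasurableSpace X] {Ω : Type*} [MeasurableSpace Ω] {μ : Measure Ω}
  {P : Measure (X × ℝ)} {Z : ℕ → Ω → X × ℝ} {ξ : X × ℝ → ℝ} {k : X → X → ℝ} {C : ℝ}

theorem integrable_sq_mul_kernel_diag (hξ : MemLp ξ 2 P)
    (hk : Measurable fun z : X × X => k z.1 z.2) (hC : ∀ x y, |k x y| ≤ C) :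
    Integrable (fun z : X × ℝ => ξ z * ξ z * k z.1 z.1) P := by
  have h1 : Measurable fun z : X × ℝ => (z.1, z.1) := by fun_prop
  exact (hξ.integrable_mul hξ).mul_bdd (hk.comp h1).aestronglyMeasurable
    (ae_of_all _ fun z => hC z.1 z.1)

theorem integrable_hasLaw_comp {Y : Type*} [MeasurableSpace Y] {ν : Measure Y} {T : Ω → Y}
    (hT : HasLaw T ν μ) {g : Y → ℝ} (hg : Integrable g ν) : Integrable (fun ω => g (T ω)) μ := by
  rw [← hT.map_eq] at hg
  exact hg.comp_aemeasurable hT.aemeasurable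

variable [IsProbabilityMeasure μ]

theorem hasLaw_pair (hlaw : ∀ i, HasLaw (Z i) P μ) (hindep : iIndepFun Z μ) {i j : ℕ}
    (hij : i ≠ j) : HasLaw (fun ω => (Z i ω, Z j ω)) (P.prod P) μ where
  aemeasurable := (hlaw i).aemeasurable.prodMk (hlaw j).aemeasurable
  map_eq := by
    rw [(indepFun_iff_map_prod_eq_prod_map_map (hlaw i).aemeasurable (hlaw j).aemeasurable).1
      (hindep.indepFun hij), (hlaw i).map_eq, (hlaw j).map_eq]

variable [IsProbabilityMeasure P]

theorem integrable_mul_mul_kernel_prod (hξ : MemLp ξ 2 P)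
    (hk : Measurable fun z : X × X => k z.1 z.2) (hC : ∀ x y, |k x y| ≤ C) :
    Integrable (fun z : (X × ℝ) × (X × ℝ) => ξ z.1 * ξ z.2 * k z.1.1 z.2.1) (P.prod P) := by
  have h1 : Measurable fun z : (X × ℝ) × (X × ℝ) => (z.1.1, z.2.1) := by fun_prop
  have hint := hξ.integrable one_le_two
  exact (hint.mul_prod hint).mul_bdd (hk.comp h1).aestronglyMeasurable
    (ae_of_all _ fun z => hC z.1.1 z.2.1)

theorem integrable_double_term (hlaw : ∀ i, HasLaw (Z i) P μ) (hindep : iIndepFun Z μ)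
    (hξ : MemLp ξ 2 P) (hk : Measurable fun z : X × X => k z.1 z.2) (hC : ∀ x y, |k x y| ≤ C)
    (i j : ℕ) :
    Integrable (fun ω => ξ (Z i ω) * ξ (Z j ω) * k (Z i ω).1 (Z j ω).1) μ := by
  rcases eq_or_ne i j with rfl | hij
  · exact integrable_hasLaw_comp (hlaw i) (integrable_sq_mul_kernel_diag hξ hk hC)
  · exact integrable_hasLaw_comp (hasLaw_pair hlaw hindep hij)
      (integrable_mul_mul_kernel_prod hξ hk hC)

theorem integrable_double_sum (hlaw : ∀ i, HasLaw (Z i) P μ) (hindep : iIndepFun Z μ)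
    (hξ : MemLp ξ 2 P) (hk : Measurable fun z : X × X => k z.1 z.2) (hC : ∀ x y, |k x y| ≤ C)
    (n : ℕ) :
    Integrable (fun ω => ∑ i : Fin n, ∑ j : Fin n,
      ξ (Z i ω) * ξ (Z j ω) * k (Z i ω).1 (Z j ω).1) μ :=
  integrable_finsetSum _ fun i _ => integrable_finsetSum _ fun j _ =>
    integrable_double_term hlaw hindep hξ hk hC i j

/-- The `n` diagonal terms are bounded through `C`; by independence and Fubini each of the `n (n -
1)` others equals `∫ ξ m`. -/
theorem integral_double_sum_le (hlaw : ∀ i, HasLaw (Z i) P μ) (hindep : iIndepFun Z μ)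
    (hξ : MemLp ξ 2 P) (hk : Measurable fun z : X × X => k z.1 z.2) (hC : ∀ x y, |k x y| ≤ C)
    {m : X → ℝ} (hm : ∀ x, ∫ z, ξ z * k x z.1 ∂P = m x) (n : ℕ) :
    ∫ ω, ∑ i : Fin n, ∑ j : Fin n, ξ (Z i ω) * ξ (Z j ω) * k (Z i ω).1 (Z j ω).1 ∂μ ≤
      n * (C * ∫ z, ξ z ^ 2 ∂P) + n * (n - 1) * ∫ z, ξ z * m z.1 ∂P := by
  set b := ∫ z, ξ z * m z.1 ∂P with hb
  have hdiag : ∀ i : ℕ, ∫ ω, ξ (Z i ω) * ξ (Z i ω) * k (Z i ω).1 (Z i ω).1 ∂μ ≤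
      C * ∫ z, ξ z ^ 2 ∂P := by
    intro i
    have h0 := integrable_sq_mul_kernel_diag hξ hk hC
    have h1 := (hlaw i).integral_comp (f := fun z => ξ z * ξ z * k z.1 z.1)
      h0.aestronglyMeasurable
    refine (h1.trans_le ?_)
    rw [← integral_const_mul]
    refine integral_mono h0 (hξ.integrable_sq.const_mul C) fun z => ?_
    have := (le_abs_self _).trans (hC z.1 z.1)
    simp only
    nlinarith [sq_nonneg (ξ z)]
  have hoff : ∀ i j : ℕ, i ≠ j →
      ∫ ω, ξ (Z i ω) * ξ (Z j ω) * k (Z i ω).1 (Z j ω).1 ∂μ = b := by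
    intro i j hij
    have h0 := integrable_mul_mul_kernel_prod hξ hk hC
    have h1 := (hasLaw_pair hlaw hindep hij).integral_comp
      (f := fun z => ξ z.1 * ξ z.2 * k z.1.1 z.2.1) h0.aestronglyMeasurable
    refine h1.trans ?_
    rw [integral_prod _ h0, hb]
    refine integral_congr_ae (ae_of_all _ fun z => ?_)
    simp only [mul_assoc]
    rw [integral_const_mul, hm]
  have hint : ∀ i j : Fin n,
      Integrable (fun ω => ξ (Z i ω) * ξ (Z j ω) * k (Z i ω).1 (Z j ω).1) μ := fun i j =>
    integrable_double_term hlaw hindep hξ hk hC i j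
  rw [integral_finsetSum _ fun i _ => integrable_finsetSum _ fun j _ => hint i j]
  have hrow : ∀ i : Fin n,
      ∫ ω, ∑ j : Fin n, ξ (Z i ω) * ξ (Z j ω) * k (Z i ω).1 (Z j ω).1 ∂μ ≤
        C * ∫ z, ξ z ^ 2 ∂P + (n - 1) * b := by
    intro i
    rw [integral_finsetSum _ fun j _ => hint i j,
      ← Finset.add_sum_erase _ _ (Finset.mem_univ i)]
    refine add_le_add (hdiag i) (le_of_eq ?_)
    have hi : 1 ≤ n := i.pos
    have hoff' : ∀ j ∈ Finset.univ.erase i,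
        ∫ ω, ξ (Z i ω) * ξ (Z j ω) * k (Z i ω).1 (Z j ω).1 ∂μ = b := fun j hj =>
      hoff i j fun h => Finset.ne_of_mem_erase hj (Fin.ext h.symm)
    rw [Finset.sum_congr rfl hoff']
    rw [Finset.sum_const, Finset.card_erase_of_mem (Finset.mem_univ i), Finset.card_univ,
      Fintype.card_fin, nsmul_eq_mul, Nat.cast_sub hi, Nat.cast_one]
  refine (Finset.sum_le_sum fun i _ => hrow i).trans_eq ?_
  rw [Finset.sum_const, Finset.card_univ, Fintype.card_fin, nsmul_eq_mul]
  ring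

end Sample

/-! ### The expected observed risk -/

section ExpectedRisk

variable {X : Type*} [MeasurableSpace X] {Ω : Type*} [MeasurableSpace Ω] {μ : Measure Ω}
  {P : Measure (X × ℝ)} [IsProbabilityMeasure P]
  {Z : ℕ → Ω → X × ℝ} {K : PosDefKernel X} {w c M l : ℝ} {n : ℕ}

namespace Bounds

theorem integral_score_sq_le (hB : Bounds K w c M)
    (hy : Integrable (fun z : X × ℝ => z.2 ^ 2) P) (q : K.Space × ℝ) :
    ∫ z, score w q z ^ 2 ∂P ≤ 4 * risk w P q.1 q.2 := by
  rw [risk, ← integral_const_mul]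
  exact integral_mono (hB.memLp_score hy q).integrable_sq
    ((hB.integrable_loss hy q).const_mul 4) fun z => slope_sq_le hB.w_pos hB.w_lt_one _

theorem integrable_score_mul_fst (hB : Bounds K w c M)
    (hy : Integrable (fun z : X × ℝ => z.2 ^ 2) P) (q : K.Space × ℝ) :
    Integrable (fun z => score w q z * q.1 z.1) P := by
  simpa [predict] using hB.integrable_score_mul hy q (q.1, 0)

theorem integrable_sum_score_mul_fst (hB : Bounds K w c M)
    (hy : Integrable (fun z : X × ℝ => z.2 ^ 2) P) (hlaw : ∀ i, HasLaw (Z i) P μ)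
    (q : K.Space × ℝ) :
    Integrable (fun ω => ∑ i : Fin n, score w q (Z i ω) * q.1 (Z i ω).1) μ :=
  integrable_finsetSum _ fun i _ =>
    integrable_hasLaw_comp (hlaw i) (hB.integrable_score_mul_fst hy q)

variable [IsProbabilityMeasure μ]

theorem integrable_scoreSum_sq (hB : Bounds K w c M)
    (hy : Integrable (fun z : X × ℝ => z.2 ^ 2) P) (hlaw : ∀ i, HasLaw (Z i) P μ)
    (hindep : iIndepFun Z μ) (q : K.Space × ℝ) :
    Integrable (fun ω => scoreSum w (fun i : Fin n => Z i ω) q ^ 2) μ := by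
  simp only [scoreSum_sq]
  exact integrable_double_sum (k := fun _ _ => 1) (C := 1) hlaw hindep (hB.memLp_score hy q)
    measurable_const (fun _ _ => by simp) n

theorem integral_scoreSum_sq_le (hB : Bounds K w c M)
    (hy : Integrable (fun z : X × ℝ => z.2 ^ 2) P) (hlaw : ∀ i, HasLaw (Z i) P μ)
    (hindep : iIndepFun Z μ) {q : K.Space × ℝ}
    (hq : ∀ q' : K.Space × ℝ, penRisk w P l q ≤ penRisk w P l q') :
    ∫ ω, scoreSum w (fun i : Fin n => Z i ω) q ^ 2 ∂μ ≤ n * ∫ z, score w q z ^ 2 ∂P := by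
  simp only [scoreSum_sq]
  have h := integral_double_sum_le (k := fun _ _ => 1) (C := 1) (m := fun _ => 0) hlaw hindep
    (hB.memLp_score hy q) measurable_const (fun _ _ => by simp)
    (fun _ => by simpa [predict] using hB.integral_score_mul_predict hy hq (0, 1)) n
  simpa using h

theorem integrable_norm_gradFst_sq (hB : Bounds K w c M)
    (hy : Integrable (fun z : X × ℝ => z.2 ^ 2) P) (hlaw : ∀ i, HasLaw (Z i) P μ)
    (hindep : iIndepFun Z μ) (lam : ℝ) (q : K.Space × ℝ) :
    Integrable (fun ω => ‖gradFst w lam (fun i : Fin n => Z i ω) q‖ ^ 2) μ := by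
  simp only [norm_gradFst_sq]
  exact ((integrable_double_sum hlaw hindep (hB.memLp_score hy q) hB.meas
    (abs_kernel_le hB.M_nonneg hB.diag_le) n).sub
    ((hB.integrable_sum_score_mul_fst hy hlaw q).const_mul _)).add (integrable_const _)

/-- The first-order condition for `q`, tested on kernel sections and on `q.1`, says that the
summands are centred once the penalty `n * l` is split evenly among them. -/
theorem integral_norm_gradFst_sq_le (hB : Bounds K w c M)
    (hy : Integrable (fun z : X × ℝ => z.2 ^ 2) P) (hlaw : ∀ i, HasLaw (Z i) P μ)
    (hindep : iIndepFun Z μ) {q : K.Space × ℝ}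
    (hq : ∀ q' : K.Space × ℝ, penRisk w P l q ≤ penRisk w P l q') :
    ∫ ω, ‖gradFst w (n * l) (fun i : Fin n => Z i ω) q‖ ^ 2 ∂μ ≤
      n * (M ^ 2 * ∫ z, score w q z ^ 2 ∂P) := by
  have hsec : ∀ x, ∫ z, score w q z * K x z.1 ∂P = 2 * l * q.1 x := fun x => by
    have := hB.integral_score_mul_predict hy hq (K.feature x, 0)
    simp only [predict, zero_add, inner_feature, feature_apply] at this
    simpa only [K.symm x] using this
  have hfst : ∫ z, score w q z * q.1 z.1 ∂P = 2 * l * ‖q.1‖ ^ 2 := by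
    have := hB.integral_score_mul_predict hy hq (q.1, 0)
    simpa only [predict, zero_add, real_inner_self_eq_norm_sq] using this
  have hdouble := integral_double_sum_le hlaw hindep (hB.memLp_score hy q) hB.meas
    (abs_kernel_le hB.M_nonneg hB.diag_le) hsec n
  have hcross : ∫ ω, ∑ i : Fin n, score w q (Z i ω) * q.1 (Z i ω).1 ∂μ =
      n * (2 * l * ‖q.1‖ ^ 2) := by
    have hint := hB.integrable_score_mul_fst hy q
    have hint' : ∀ i : Fin n, Integrable (fun ω => score w q (Z i ω) * q.1 (Z i ω).1) μ :=
      fun i => integrable_hasLaw_comp (hlaw i) hint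
    rw [integral_finsetSum _ fun i _ => hint' i]
    have : ∀ i : ℕ, ∫ ω, score w q (Z i ω) * q.1 (Z i ω).1 ∂μ = 2 * l * ‖q.1‖ ^ 2 := fun i =>
      ((hlaw i).integral_comp (f := fun z => score w q z * q.1 z.1)
        hint.aestronglyMeasurable).trans hfst
    simp [this]
  have hmean : ∫ z, score w q z * (2 * l * q.1 z.1) ∂P = 4 * l ^ 2 * ‖q.1‖ ^ 2 := by
    have : ∀ z : X × ℝ, score w q z * (2 * l * q.1 z.1) = 2 * l * (score w q z * q.1 z.1) :=
      fun z => by ring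
    simp only [this]
    rw [integral_const_mul, hfst]
    ring
  rw [hmean] at hdouble
  simp only [norm_gradFst_sq]
  have hi := integrable_double_sum hlaw hindep (hB.memLp_score hy q) hB.meas
    (abs_kernel_le hB.M_nonneg hB.diag_le) n
  have hi' := (hB.integrable_sum_score_mul_fst (n := n) hy hlaw q).const_mul (4 * (n * l))
  have hsub := hi.sub hi'
  simp only [Pi.sub_def] at hsub
  rw [integral_add hsub (integrable_const _), integral_sub hi hi', integral_const_mul, hcross,
    integral_const, probReal_univ, one_smul]
  -- The multiples of `l ^ 2 * ‖q.1‖ ^ 2` add up to `4 n (n - 1) - 8 n ^ 2 + 4 n ^ 2 = -4 n`.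
  have : 0 ≤ 4 * n * l ^ 2 * ‖q.1‖ ^ 2 := by positivity
  nlinarith

theorem integrable_observedRisk (hB : Bounds K w c M)
    (hy : Integrable (fun z : X × ℝ => z.2 ^ 2) P) (hlaw : ∀ i, HasLaw (Z i) P μ)
    (hindep : iIndepFun Z μ) (hn : 1 ≤ n) (hl : 0 < l) :
    Integrable (fun ω => observedRisk w P K (n * l) (fun i : Fin n => Z i ω)) μ := by
  have hn' : (0 : ℝ) < n := by exact_mod_cast hn
  obtain ⟨q, hq, -⟩ := hB.exists_unique_penRisk_min hy hl (by simp)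
  have hZ : AEMeasurable (fun ω => fun i : Fin n => Z i ω) μ :=
    aemeasurable_pi_iff.2 fun i => (hlaw i).aemeasurable
  have hbound : Integrable (fun ω => penRisk w P l q + (1 + 2 / c + 8 * M ^ 2 / l) *
      ((1 / c + 2 * M ^ 2 / l) * (scoreSum w (fun i : Fin n => Z i ω) q ^ 2 / n ^ 2) +
        2 / l * (‖gradFst w (n * l) (fun i : Fin n => Z i ω) q‖ ^ 2 / n ^ 2))) μ :=
    (integrable_const _).add (((((hB.integrable_scoreSum_sq hy hlaw hindep q).div_const
      _).const_mul _).add (((hB.integrable_norm_gradFst_sq hy hlaw hindep _ q).div_const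
      _).const_mul _)).const_mul _)
  refine hbound.mono' ((hB.measurable_observedRisk P hn (mul_pos hn' hl)).comp_aemeasurable
    hZ).aestronglyMeasurable (ae_of_all _ fun ω => ?_)
  rw [observedRisk, Real.norm_of_nonneg (hB.risk_nonneg _)]
  exact hB.observedRisk_le hy hn hl hq _

theorem integral_observedRisk_le (hB : Bounds K w c M)
    (hy : Integrable (fun z : X × ℝ => z.2 ^ 2) P) (hlaw : ∀ i, HasLaw (Z i) P μ)
    (hindep : iIndepFun Z μ) (hn : 1 ≤ n) (hl : 0 < l) (p : K.Space × ℝ) :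
    ∫ ω, observedRisk w P K (n * l) (fun i : Fin n => Z i ω) ∂μ ≤ penRisk w P l p +
      (1 + 2 / c + 8 * M ^ 2 / l) * (1 / c + 4 * M ^ 2 / l) *
        (4 * penRisk w P l (0 : K.Space × ℝ)) / n := by
  have hn' : (0 : ℝ) < n := by exact_mod_cast hn
  have hc := hB.c_pos
  obtain ⟨q, hq, -⟩ := hB.exists_unique_penRisk_min hy hl (by simp)
  set E := 4 * penRisk w P l (0 : K.Space × ℝ)
  have hS := hB.integrable_scoreSum_sq (n := n) hy hlaw hindep q
  have hG := hB.integrable_norm_gradFst_sq (n := n) hy hlaw hindep (n * l) q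
  have hS1 := (hS.div_const ((n : ℝ) ^ 2)).const_mul (1 / c + 2 * M ^ 2 / l)
  have hG1 := (hG.div_const ((n : ℝ) ^ 2)).const_mul (2 / l)
  -- Comparing `q` with `0` bounds its risk by that of `0`, which does not depend on `l`.
  have hE : ∫ z, score w q z ^ 2 ∂P ≤ E := by
    refine (hB.integral_score_sq_le hy q).trans (mul_le_mul_of_nonneg_left ?_ (by norm_num))
    refine le_trans ?_ (hq 0)
    unfold penRisk
    have : 0 ≤ l * ‖q.1‖ ^ 2 := by positivity
    linarith
  have hES : ∫ ω, scoreSum w (fun i : Fin n => Z i ω) q ^ 2 ∂μ ≤ n * E :=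
    (hB.integral_scoreSum_sq_le hy hlaw hindep hq).trans (mul_le_mul_of_nonneg_left hE hn'.le)
  have hEG : ∫ ω, ‖gradFst w (n * l) (fun i : Fin n => Z i ω) q‖ ^ 2 ∂μ ≤ n * (M ^ 2 * E) :=
    (hB.integral_norm_gradFst_sq_le hy hlaw hindep hq).trans (by gcongr)
  calc ∫ ω, observedRisk w P K (n * l) (fun i : Fin n => Z i ω) ∂μ
      ≤ ∫ ω, (penRisk w P l q + (1 + 2 / c + 8 * M ^ 2 / l) *
        ((1 / c + 2 * M ^ 2 / l) * (scoreSum w (fun i : Fin n => Z i ω) q ^ 2 / n ^ 2) +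
          2 / l * (‖gradFst w (n * l) (fun i : Fin n => Z i ω) q‖ ^ 2 / n ^ 2))) ∂μ :=
        integral_mono (hB.integrable_observedRisk hy hlaw hindep hn hl)
          ((integrable_const _).add ((hS1.add hG1).const_mul _))
          fun ω => hB.observedRisk_le hy hn hl hq _
    _ = penRisk w P l q + (1 + 2 / c + 8 * M ^ 2 / l) * ((1 / c + 2 * M ^ 2 / l) *
          ((∫ ω, scoreSum w (fun i : Fin n => Z i ω) q ^ 2 ∂μ) / n ^ 2) +
          2 / l * ((∫ ω, ‖gradFst w (n * l) (fun i : Fin n => Z i ω) q‖ ^ 2 ∂μ) / n ^ 2)) := by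
        have hadd := (hS1.add hG1).const_mul (1 + 2 / c + 8 * M ^ 2 / l)
        simp only [Pi.add_apply] at hadd
        rw [integral_add (integrable_const _) hadd, integral_const_mul,
          integral_add hS1 hG1, integral_const_mul, integral_const_mul, integral_div,
          integral_div, integral_const, probReal_univ, one_smul]
    _ ≤ penRisk w P l p + (1 + 2 / c + 8 * M ^ 2 / l) * ((1 / c + 2 * M ^ 2 / l) *
          (n * E / n ^ 2) + 2 / l * (n * (M ^ 2 * E) / n ^ 2)) := by
        gcongr
        exact hq p
    _ = _ := by
        field_simp
        ring

end Bounds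

end ExpectedRisk

/-! ### Consistency -/

section Consistency

variable {X : Type*} [MeasurableSpace X] {K : PosDefKernel X} {w c M : ℝ}

theorem exists_bounds (hK : Measurable fun z : X × X => K z.1 z.2)
    (hM : BddAbove (Set.range fun x => K x x ^ (1 / 2 : ℝ))) (hw0 : 0 < w) (hw1 : w < 1) :
    ∃ c M, Bounds K w c M := by
  obtain ⟨B, hB⟩ := hM
  refine ⟨min w (1 - w), max B 0, hw0, hw1, lt_min hw0 (sub_pos.2 hw1), min_le_left _ _,
    min_le_right _ _, le_max_right _ _, fun x => ?_, hK⟩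
  have h0 : 0 ≤ K x x := by rw [← norm_feature_sq]; positivity
  have h1 : √(K x x) ≤ max B 0 := by
    rw [Real.sqrt_eq_rpow]
    exact (hB ⟨x, rfl⟩).trans (le_max_left _ _)
  exact (Real.sqrt_le_left (le_max_right _ _)).1 h1

/-- Positivity of the penalty is needed only for large `n`, where the divergence provides it. -/
theorem eventually_penalty_pos {lam : ℕ → ℝ}
    (h : Tendsto (fun n : ℕ => lam n / (n : ℝ) ^ (2 / 3 : ℝ)) atTop atTop) :
    ∀ᶠ n in atTop, 1 ≤ n ∧ 0 < lam n := by
  filter_upwards [h.eventually_gt_atTop 0, eventually_ge_atTop 1] with n hn h1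
  have : (0 : ℝ) < (n : ℝ) ^ (2 / 3 : ℝ) := Real.rpow_pos_of_pos (by exact_mod_cast h1) _
  exact ⟨h1, (div_pos_iff_of_pos_right this).1 hn⟩

/-- `n / λ ^ 2 = (λ / n ^ (2 / 3)) ^ (-2) * n ^ (-1 / 3)`, and both factors tend to `0`. -/
theorem tendsto_div_sq_penalty {lam : ℕ → ℝ}
    (h : Tendsto (fun n : ℕ => lam n / (n : ℝ) ^ (2 / 3 : ℝ)) atTop atTop) :
    Tendsto (fun n : ℕ => (n / lam n) ^ 2 / (n : ℝ)) atTop (𝓝 0) := by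
  have h1 : Tendsto (fun n : ℕ => ((lam n / (n : ℝ) ^ (2 / 3 : ℝ))⁻¹) ^ 2 *
      (n : ℝ) ^ (-(1 / 3) : ℝ)) atTop (𝓝 0) := by
    simpa using (h.inv_tendsto_atTop.pow 2).mul
      ((tendsto_rpow_neg_atTop (by norm_num : (0 : ℝ) < 1 / 3)).comp tendsto_natCast_atTop_atTop)
  refine h1.congr' ?_
  filter_upwards [eventually_ge_atTop 1] with n hn
  have hn' : (0 : ℝ) < n := by exact_mod_cast hn
  have e1 : ((n : ℝ) ^ (2 / 3 : ℝ)) ^ 2 * (n : ℝ) ^ (-(1 / 3) : ℝ) = n := by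
    rw [← Real.rpow_natCast, ← Real.rpow_mul hn'.le, ← Real.rpow_add hn']
    norm_num
  have e2 : ((n : ℝ) / lam n) ^ 2 / n = n / lam n ^ 2 := by
    field_simp
  rw [e2, inv_div, div_pow, div_mul_eq_mul_div, e1]

theorem Bounds.tendsto_penRisk_bound (hB : Bounds K w c M) (P : Measure (X × ℝ)) {lam : ℕ → ℝ}
    (h1 : Tendsto (fun n : ℕ => lam n / (n : ℝ) ^ (2 / 3 : ℝ)) atTop atTop)
    (h2 : Tendsto (fun n : ℕ => lam n / (n : ℝ)) atTop (𝓝 0)) (p : K.Space × ℝ) :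
    Tendsto (fun n : ℕ => penRisk w P (lam n / n) p +
      (1 + 2 / c + 8 * M ^ 2 / (lam n / n)) * (1 / c + 4 * M ^ 2 / (lam n / n)) *
        (4 * penRisk w P (lam n / n) (0 : K.Space × ℝ)) / n) atTop
      (𝓝 (risk w P p.1 p.2)) := by
  have hc := hB.c_pos
  have hR := hB.risk_nonneg (Q := P) 0
  set R := risk w P (0 : K.Space × ℝ).1 (0 : K.Space × ℝ).2
  have h0 : ∀ l, penRisk w P l (0 : K.Space × ℝ) = R := fun l => by simp [penRisk, R]
  have ha : Tendsto (fun n : ℕ => penRisk w P (lam n / n) p) atTop (𝓝 (risk w P p.1 p.2)) := by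
    simpa [penRisk] using (h2.mul_const (‖p.1‖ ^ 2)).const_add (risk w P p.1 p.2)
  simp only [h0]
  set A := 1 + 2 / c + 8 * M ^ 2 with hA
  have hApos : 0 ≤ A := by positivity
  have hb : Tendsto (fun n : ℕ => A ^ 2 * (4 * R) * (2 * ((n / lam n) ^ 2 / (n : ℝ) + 1 / n)))
      atTop (𝓝 0) := by
    simpa using (((tendsto_div_sq_penalty h1).add
      (tendsto_const_div_atTop_nhds_zero_nat 1)).const_mul 2).const_mul (A ^ 2 * (4 * R))
  have hb' : Tendsto (fun n : ℕ => (1 + 2 / c + 8 * M ^ 2 / (lam n / n)) *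
      (1 / c + 4 * M ^ 2 / (lam n / n)) * (4 * R) / n) atTop (𝓝 0) := by
    refine squeeze_zero' ?_ ?_ hb
    · filter_upwards [eventually_penalty_pos h1] with n ⟨hn, hl⟩
      positivity
    · filter_upwards [eventually_penalty_pos h1] with n ⟨hn, hl⟩
      have hn' : (0 : ℝ) < n := by exact_mod_cast hn
      -- Both factors of the error are `O(1 + t)`, and `(1 + t) ^ 2 ≤ 2 (t ^ 2 + 1)`.
      set t : ℝ := n / lam n with ht
      have htpos : 0 < t := by positivity
      have e1 : ∀ x : ℝ, x / (lam n / n) = x * t := fun x => by rw [ht]; field_simp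
      rw [e1, e1]
      have f1 : 1 + 2 / c + 8 * M ^ 2 * t ≤ A * (1 + t) := by
        have : 0 ≤ 8 * M ^ 2 + (1 + 2 / c) * t := by positivity
        rw [hA]; linarith
      have f2 : 1 / c + 4 * M ^ 2 * t ≤ A * (1 + t) := by
        have : 0 ≤ 1 + 1 / c + 8 * M ^ 2 + (1 + 2 / c) * t + 4 * M ^ 2 * t := by positivity
        rw [hA]; linarith [show 2 / c = 2 * (1 / c) by ring]
      have f3 : (1 + 2 / c + 8 * M ^ 2 * t) * (1 / c + 4 * M ^ 2 * t) ≤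
          (A * (1 + t)) * (A * (1 + t)) := by gcongr
      have f4 : (A * (1 + t)) * (A * (1 + t)) ≤ A ^ 2 * (2 * (t ^ 2 + 1)) := by
        rw [show (A * (1 + t)) * (A * (1 + t)) = A ^ 2 * (1 + t) ^ 2 by ring]
        exact mul_le_mul_of_nonneg_left (by nlinarith [sq_nonneg (1 - t)]) (sq_nonneg A)
      calc (1 + 2 / c + 8 * M ^ 2 * t) * (1 / c + 4 * M ^ 2 * t) * (4 * R) / n
          ≤ A ^ 2 * (2 * (t ^ 2 + 1)) * (4 * R) / n := by
            have := f3.trans f4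
            gcongr
        _ = _ := by ring
  simpa using ha.add hb'

theorem Bounds.idealRisk_le (hB : Bounds K w c M) (P : Measure (X × ℝ)) (q : K.Space × ℝ) :
    idealRisk w P K ≤ risk w P q.1 q.2 :=
  ciInf_le ⟨0, by rintro _ ⟨q, rfl⟩; exact hB.risk_nonneg q⟩ q

end Consistency

end Expectile

theorem theorem1 {X : Type*} [MeasurableSpace X]
    {Ω : Type*} [MeasurableSpace Ω] (μ : Measure Ω) [IsProbabilityMeasure μ]
    (P : Measure (X × ℝ)) [IsProbabilityMeasure P]
    -- the observations: independent, each with law `P`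
    (Z : ℕ → Ω → X × ℝ) (hlaw : ∀ i, HasLaw (Z i) P μ) (hindep : iIndepFun Z μ)
    -- the response has a finite second moment
    (hy : Integrable (fun z : X × ℝ => z.2 ^ 2) P)
    -- the kernel is measurable, and `sup_x K(x,x)^{1/2}` is finite
    (K : Expectile.PosDefKernel X) (hKmeas : Measurable (fun z : X × X => K z.1 z.2))
    (hM : BddAbove (Set.range fun x => (K x x) ^ (1 / 2 : ℝ)))
    (w : ℝ) (hw0 : 0 < w) (hw1 : w < 1)
    (lam : ℕ → ℝ)
    (hlam1 : Tendsto (fun n : ℕ => lam n / (n : ℝ) ^ (2 / 3 : ℝ)) atTop atTop)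
    (hlam2 : Tendsto (fun n : ℕ => lam n / (n : ℝ)) atTop (𝓝 0)) :
    -- the risks are expectations of integrable random variables
    (∀ (f : K.Space) (a : ℝ), Integrable (fun z => Expectile.loss w (z.2 - a - f z.1)) P) ∧
    -- the estimator is well defined
    (∀ n : ℕ, 1 ≤ n → 0 < lam n → ∀ d : Fin n → X × ℝ,
      ∃! q : K.Space × ℝ, Expectile.IsMinimizer w K (lam n) d q) ∧
    -- the observed risk is an integrable random variable
    (∀ n : ℕ, 1 ≤ n → 0 < lam n →
      Integrable (fun ω => Expectile.observedRisk w P K (lam n) (fun i : Fin n => Z i ω)) μ) ∧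
    -- the expected observed risk converges to the ideal risk
    Tendsto
      (fun n : ℕ => ∫ ω, Expectile.observedRisk w P K (lam n) (fun i : Fin n => Z i ω) ∂μ)
      atTop (𝓝 (Expectile.idealRisk w P K)) ∧
    -- the observed risk converges to the ideal risk in probability
    TendstoInMeasure μ
      (fun (n : ℕ) (ω : Ω) =>
        Expectile.observedRisk w P K (lam n) (fun i : Fin n => Z i ω) - Expectile.idealRisk w P K)
      atTop (fun _ => 0) := by
  obtain ⟨c, M, hB⟩ := Expectile.exists_bounds hKmeas hM hw0 hw1
  -- A penalty `lam n` on a sum of `n` losses is a penalty `lam n / n` on their average.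
  have hscale : ∀ n : ℕ, 1 ≤ n → (n : ℝ) * (lam n / n) = lam n := fun n hn => by
    have : (n : ℝ) ≠ 0 := by positivity
    field_simp
  have hint : ∀ n : ℕ, 1 ≤ n → 0 < lam n →
      Integrable (fun ω => Expectile.observedRisk w P K (lam n) (fun i : Fin n => Z i ω)) μ := by
    intro n hn hl
    have := hB.integrable_observedRisk hy hlaw hindep hn
      (div_pos hl (by exact_mod_cast hn : (0 : ℝ) < n))
    rwa [hscale n hn] at this
  have hpos := Expectile.eventually_penalty_pos hlam1
  -- This holds for every `n`, since `estimator` is an element of `K.Space × ℝ` even where no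
  -- minimizer is known to exist.
  have hge : ∀ n (ω : Ω), Expectile.idealRisk w P K ≤
      Expectile.observedRisk w P K (lam n) (fun i : Fin n => Z i ω) := fun n ω =>
    hB.idealRisk_le P _
  have hlim : Tendsto
      (fun n : ℕ => ∫ ω, Expectile.observedRisk w P K (lam n) (fun i : Fin n => Z i ω) ∂μ)
      atTop (𝓝 (Expectile.idealRisk w P K)) := by
    refine tendsto_order.2 ⟨fun a ha => ?_, fun b hb => ?_⟩
    · filter_upwards [hpos] with n ⟨hn, hl⟩
      refine ha.trans_le ?_
      have := integral_mono (integrable_const (Expectile.idealRisk w P K)) (hint n hn hl) (hge n)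
      simpa using this
    -- The infimum need not be attained; a fixed `p` with risk below `b` suffices.
    · obtain ⟨p, hp⟩ := exists_lt_of_ciInf_lt hb
      filter_upwards [hpos, (hB.tendsto_penRisk_bound P hlam1 hlam2 p).eventually_lt_const hp]
        with n ⟨hn, hl⟩ hlt
      have := hB.integral_observedRisk_le hy hlaw hindep hn
        (div_pos hl (by exact_mod_cast hn : (0 : ℝ) < n)) p
      rw [hscale n hn] at this
      exact this.trans_lt hlt
  refine ⟨fun f a => hB.integrable_loss hy (f, a),
    fun n hn hl d => hB.existsUnique_isMinimizer hn hl d, hint, hlim, ?_⟩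
  rw [tendstoInMeasure_iff_measureReal_norm]
  intro ε hε
  have hzero : Tendsto (fun n : ℕ => ε⁻¹ *
      (∫ ω, Expectile.observedRisk w P K (lam n) (fun i : Fin n => Z i ω) ∂μ -
        Expectile.idealRisk w P K)) atTop (𝓝 0) := by
    simpa using (hlim.sub_const (Expectile.idealRisk w P K)).const_mul ε⁻¹
  refine squeeze_zero' (Eventually.of_forall fun n => measureReal_nonneg) ?_ hzero
  filter_upwards [hpos] with n ⟨hn, hl⟩
  have hmarkov := mul_meas_ge_le_integral_of_nonneg (μ := μ)
    (f := fun ω => Expectile.observedRisk w P K (lam n) (fun i : Fin n => Z i ω) -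
      Expectile.idealRisk w P K) (ae_of_all _ fun ω => sub_nonneg.2 (hge n ω))
    ((hint n hn hl).sub (integrable_const _)) ε
  rw [integral_sub (hint n hn hl) (integrable_const _), integral_const, probReal_univ,
    one_smul] at hmarkov
  have hset : ∀ ω, ‖Expectile.observedRisk w P K (lam n) (fun i : Fin n => Z i ω) -
      Expectile.idealRisk w P K - 0‖ = Expectile.observedRisk w P K (lam n)
        (fun i : Fin n => Z i ω) - Expectile.idealRisk w P K := fun ω => by
    rw [sub_zero, Real.norm_of_nonneg (sub_nonneg.2 (hge n ω))]
  simp only [hset]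
  rw [inv_mul_eq_div, le_div_iff₀' hε]
  exact hmarkov
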